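/- Fix $\delta \in (0, 0.1]$. Let $d = d(n)$ and $k = k(n)$ be sequences of natural numbers with $k \le d$ and $n = o(\min(d, k^{2-\delta}))$ as $n \to \infty$, and let $\theta = \theta(n) \in (0,1)$. Let $\mathcal Q_n$ be the law of $n$ independent samples from $N(0, \mathrm{Id}_{d+1})$. Let $\mathcal P_n$ be the law of $z_1, \dots, z_n \in \mathbb R^{d+1}$ obtained as follows: draw once a unit vector $x \in \mathbb R^{d+1}$ whose first coordinate is $-1/\sqrt{k+1}$ and whose other $d$ coordinates form a uniformly random vector in $\{\pm 1/\sqrt{k+1}, 0\}^d$ with exactly $k$ non-zero entries; given $x$, draw $z_1, \dots, z_n$ independently from $N(0, \mathrm{Id}_{d+1} - \theta\, x x^\top)$. Then, for every polynomial $f : \mathbb R^{n \times (d+1)} \to \mathbb R$, not identically zero, of degree at most $k^\delta$ with $\mathbb E_{\mathcal Q_n} f = 0$, $$\frac{\mathbb E_{\mathcal P_n} f}{\sqrt{\mathbb E_{\mathcal Q_n} f^2}} \le 1 + o(1),$$ where the $o(1)$ tends to $0$ as $n \to \infty$, uniformly over $f$ and $\theta$. Moreover the low-degree likelihood ratio stays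 bounded: the orthogonal projection $L_n^{\le D}$ in $L^2(\mathcal Q_n)$ of $L_n = d\mathcal P_n/d\mathcal Q_n$ onto the polynomials of degree at most $D = k^\delta$ satisfies $\|L_n^{\le D}\|_{L^2(\mathcal Q_n)} \le C$ for all large $n$, with $C$ independent of $\theta$. -/

import Mathlib

open MeasureTheory ProbabilityTheory Filter Topology Asymptotics
open scoped ENNReal

noncomputable section

namespace NegSPCA

/-- The space `ℝ^{n × (d+1)}` of `n` samples, each a vector of `ℝ^{d+1}`. -/
abbrev Samples (n d : ℕ) : Type := Fin n → EuclideanSpace ℝ (Fin (d + 1))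

/-- The sign patterns in `{-1, 0, 1}^d` with exactly `k` non-zero entries. -/
def signPatterns (d k : ℕ) : Finset (Fin d → SignType) :=
  Finset.univ.filter fun s => (Finset.univ.filter fun i => s i ≠ 0).card = k

/-- The spike attached to a sign pattern `s`: the vector of `ℝ^{d+1}` whose first coordinate is
`-1/√(k+1)` and whose other coordinates are `s i / √(k+1)`. It is a unit vector when `s` has
exactly `k` non-zero entries. -/
def spike (d k : ℕ) (s : Fin d → SignType) : Fin (d + 1) → ℝ :=
  Fin.cons (-1 / √((k : ℝ) + 1)) fun i => ((s i : SignType) : ℝ) / √((k : ℝ) + 1)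

/-- The covariance matrix `Id - θ x xᵀ` of the planted samples with spike `x`. -/
def spikedCov (θ : ℝ) {d : ℕ} (x : Fin (d + 1) → ℝ) :
    Matrix (Fin (d + 1)) (Fin (d + 1)) ℝ :=
  1 - θ • Matrix.vecMulVec x x

/-- The null distribution of `n` samples: independent draws from `N(0, Id)` on `ℝ^{d+1}`. -/
def null (d n : ℕ) : Measure (Samples n d) :=
  Measure.pi fun _ : Fin n => multivariateGaussian 0 1

/-- The planted distribution of `n` samples: a spike `x` is drawn uniformly once and for all, then
the `n` samples are independent draws from `N(0, Id - θ x xᵀ)`. -/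
def planted (θ : ℝ) (d k n : ℕ) : Measure (Samples n d) :=
  ((signPatterns d k).card : ℝ≥0∞)⁻¹ •
    ∑ s ∈ signPatterns d k,
      Measure.pi fun _ : Fin n => multivariateGaussian 0 (spikedCov θ (spike d k s))

/-- Real polynomials in the `n (d+1)` coordinates of the samples. -/
abbrev SamplePoly (n d : ℕ) : Type := MvPolynomial (Fin n × Fin (d + 1)) ℝ

/-- The value of a polynomial at the samples `z`. -/
def SamplePoly.evalAt {n d : ℕ} (f : SamplePoly n d) (z : Samples n d) : ℝ :=
  MvPolynomial.eval (fun p : Fin n × Fin (d + 1) => z p.1 p.2) f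

/-- The likelihood ratio `dP/dQ`, as a real function. -/
def likelihoodRatio {n d : ℕ} (P Q : Measure (Samples n d)) (z : Samples n d) : ℝ :=
  (P.rnDeriv Q z).toReal

/-- `g` is the `D`-low-degree likelihood ratio of `P` against `Q`: the likelihood ratio exists and
lies in `L²(Q)`, and `g` is its orthogonal projection in `L²(Q)` onto the space of polynomials of
degree at most `D`. -/
structure IsLowDegreeLR {n d : ℕ} (P Q : Measure (Samples n d)) (D : ℝ) (g : SamplePoly n d) :
    Prop where
  absolutelyContinuous : P ≪ Q
  memLp : MemLp (likelihoodRatio P Q) 2 Q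
  degree_le : (g.totalDegree : ℝ) ≤ D
  orthogonal : ∀ h : SamplePoly n d, (h.totalDegree : ℝ) ≤ D →
    ∫ z, (likelihoodRatio P Q z - g.evalAt z) * h.evalAt z ∂Q = 0

end NegSPCA

end

noncomputable section

namespace NegSPCA

/-! ### Domination of the planted law by a multiple of the null law -/

section Domination

open Matrix WithLp

/-! The proof is a second-moment computation in the Hermite basis. Multivariate Hermite polynomials
`H_a` are orthogonal under the null law with squared norm `a!`, and those of order at most `D` span
the polynomials of degree at most `D`. Cauchy–Schwarz (`sq_integral_planted_le`) therefore gives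
`(E_P f)² ≤ V · E_Q f²` for centred `f`, where `V = ∑ (E_P H_a)² / a!` over `0 < |a| ≤ D` is
`hermiteEnergy`. Everything reduces to `V ≤ 1` for large `n`, uniformly in `θ`.

Given the spike `x`, Stein's identity yields `E H_a = c_{|a|} x^a` for a single sample, where `c_m`
vanishes for odd `m` and `c_m² ≤ m!`. Squaring the average over spikes introduces an independent
copy `x'`. For samples of orders `2 m_i` with `∑ m_i = M`, the multinomial theorem sums the
contributions to at most `E ⟨x, x'⟩^{2M}`. Hence `V ≤ ∑_M #{m : ∑ m_i = M} · E ⟨x, x'⟩^{2M}` over `1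
≤ M ≤ D/2` (`hermiteEnergy_le`).

The inner product is `(1 + overlap) / (k + 1)`. The overlap has exponential moments at most
`exp((k²/d)(cosh t - 1))` (`sum_exp_overlap_le`), and optimising `t` bounds its moments. The `M`-th
term is then at most `(4e² (n + M)(M + k²/d) / (k+1)²)^M` (`energy_term_le`). Under the growth
assumption with `D = ⌊k^δ⌋` the base is eventually at most `1/2`, so a geometric series gives `V ≤
1`.

For the likelihood ratio, the planted law has a bounded density, so the projection `g` exists and
satisfies `E_P g = E_Q g²`. Applying the first estimate to `g` minus its mean bounds `E_Q g²` by
`2`. -/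

lemma measure_pi_le_smul_pi {ι : Type*} [Fintype ι] {E : ι → Type*} [∀ i, MeasurableSpace (E i)]
    {μ ν : ∀ i, Measure (E i)} [∀ i, SigmaFinite (μ i)] [∀ i, SigmaFinite (ν i)]
    {c : ℝ≥0∞} (hc0 : c ≠ 0) (hc : c ≠ ∞) (h : ∀ i, μ i ≤ c • ν i) :
    Measure.pi μ ≤ c ^ Fintype.card ι • Measure.pi ν := by
  have hcn0 : c ^ Fintype.card ι ≠ 0 := pow_ne_zero _ hc0
  have hcn : c ^ Fintype.card ι ≠ ∞ := ENNReal.pow_ne_top hc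
  -- `OuterMeasure.pi` is the largest outer measure bounded by the product on boxes, so the
  -- comparison need only be checked on boxes.
  have key : ((c ^ Fintype.card ι)⁻¹ • Measure.pi μ).toOuterMeasure ≤
      OuterMeasure.pi fun i => (ν i).toOuterMeasure := by
    rw [OuterMeasure.le_pi]
    intro s _
    change ((c ^ Fintype.card ι)⁻¹ • Measure.pi μ) (Set.univ.pi s) ≤ ∏ i, ν i (s i)
    rw [Measure.smul_apply, Measure.pi_pi, smul_eq_mul, ENNReal.inv_mul_le_iff hcn0 hcn]
    calc ∏ i, μ i (s i) ≤ ∏ i, c * ν i (s i) :=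
          Finset.prod_le_prod' fun i _ => h i (s i)
      _ = c ^ Fintype.card ι * ∏ i, ν i (s i) := by
          simp [Finset.prod_mul_distrib]
  refine Measure.le_iff.2 fun s hs => ?_
  have h1 : ((c ^ Fintype.card ι)⁻¹ • Measure.pi μ) s ≤ Measure.pi ν s := by
    refine (key s).trans_eq ?_
    rw [Measure.pi, toMeasure_apply _ _ hs]
  rw [Measure.smul_apply, smul_eq_mul] at h1 ⊢
  rwa [ENNReal.inv_mul_le_iff hcn0 hcn] at h1

/-- Shrinking the variance only makes the exponential factor smaller, so the normalising constants
alone account for the factor `v^{-1/2}`. -/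
lemma gaussianReal_le_smul {v : NNReal} (hv0 : v ≠ 0) (hv1 : v ≤ 1) :
    gaussianReal 0 v ≤ ENNReal.ofReal (√v)⁻¹ • gaussianReal 0 1 := by
  rw [gaussianReal_of_var_ne_zero _ hv0, gaussianReal_of_var_ne_zero _ one_ne_zero,
    ← withDensity_smul _ (measurable_gaussianPDF _ _)]
  refine withDensity_mono (ae_of_all _ fun x => ?_)
  rw [Pi.smul_apply, smul_eq_mul, gaussianPDF, gaussianPDF, ← ENNReal.ofReal_mul (by positivity)]
  refine ENNReal.ofReal_le_ofReal ?_
  have hv : (0 : ℝ) < v := NNReal.coe_pos.2 (pos_iff_ne_zero.2 hv0)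
  have hv1' : (v : ℝ) ≤ 1 := by exact_mod_cast hv1
  rw [gaussianPDFReal, gaussianPDFReal, Real.sqrt_mul (by positivity) (v : ℝ), NNReal.coe_one,
    mul_one, mul_inv, ← mul_assoc, mul_comm (√(v : ℝ))⁻¹]
  refine mul_le_mul_of_nonneg_left (Real.exp_le_exp.2 ?_) (by positivity)
  rw [neg_div, neg_div, neg_le_neg_iff]
  exact div_le_div_of_nonneg_left (by positivity) (by positivity) (by linarith)

variable {d : ℕ}

lemma dotProduct_spikedCov_mulVec (θ : ℝ) (x y : Fin (d + 1) → ℝ) :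
    y ⬝ᵥ (spikedCov θ x *ᵥ y) = y ⬝ᵥ y - θ * (x ⬝ᵥ y) ^ 2 := by
  simp only [spikedCov, sub_mulVec, one_mulVec, smul_mulVec, vecMulVec_mulVec, dotProduct_sub,
    dotProduct_smul, smul_eq_mul, dotProduct_comm y x, op_smul_eq_smul]
  ring

lemma spikedCov_posSemidef {θ : ℝ} (hθ : θ ∈ Set.Icc (0 : ℝ) 1) {x : Fin (d + 1) → ℝ}
    (hx : x ⬝ᵥ x = 1) : (spikedCov θ x).PosSemidef := by
  refine .of_dotProduct_mulVec_nonneg ?_ fun y => ?_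
  · ext i j
    simp [spikedCov, vecMulVec_apply, Matrix.one_apply, eq_comm, mul_comm]
  · rw [star_trivial, dotProduct_spikedCov_mulVec]
    have hcs : (x ⬝ᵥ y) ^ 2 ≤ (x ⬝ᵥ x) * (y ⬝ᵥ y) := by
      simp only [dotProduct, ← pow_two]
      exact Finset.sum_mul_sq_le_sq_mul_sq _ _ _
    rw [hx, one_mul] at hcs
    have := mul_le_mul_of_nonneg_right hθ.2 (sq_nonneg (x ⬝ᵥ y))
    linarith

open scoped RealInnerProductSpace in
/-- The law of `w - ⟪x, w⟫ x + g x`, with `w` standard Gaussian and `g` of variance `v`. -/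
lemma multivariateGaussian_spikedCov_eq_conv {x : EuclideanSpace ℝ (Fin (d + 1))}
    (hx : x.ofLp ⬝ᵥ x.ofLp = 1) (v : NNReal) (hv : v ≤ 1) :
    multivariateGaussian 0 (spikedCov (1 - v) x.ofLp) =
      ((stdGaussian (EuclideanSpace ℝ (Fin (d + 1)))).map fun w => w - ⟪x, w⟫ • x) ∗
        ((gaussianReal 0 v).map fun g : ℝ => g • x) := by
  have hv1' : (v : ℝ) ≤ 1 := by exact_mod_cast hv
  have hxx : ⟪x, x⟫ = 1 := by rw [EuclideanSpace.inner_eq_star_dotProduct]; simpa using hx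
  have m1 : Measurable fun w : EuclideanSpace ℝ (Fin (d + 1)) => w - ⟪x, w⟫ • x := by fun_prop
  have m2 : Measurable fun g : ℝ => g • x := by fun_prop
  have : IsProbabilityMeasure
      ((stdGaussian (EuclideanSpace ℝ (Fin (d + 1)))).map fun w => w - ⟪x, w⟫ • x) :=
    Measure.isProbabilityMeasure_map m1.aemeasurable
  have : IsProbabilityMeasure ((gaussianReal 0 v).map fun g : ℝ => g • x) :=
    Measure.isProbabilityMeasure_map m2.aemeasurable
  -- The exponents match because `‖t‖² - (1 - v)⟪x, t⟫²` splits as `(‖t‖² - ⟪x, t⟫²) + v⟪x, t⟫²`,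
  -- the parts orthogonal to and along `x`.
  apply Measure.ext_of_charFun
  ext t
  rw [charFun_conv, charFun_multivariateGaussian
    (spikedCov_posSemidef ⟨by linarith, by simp⟩ hx)]
  have h1 : charFun ((stdGaussian (EuclideanSpace ℝ (Fin (d + 1)))).map
      fun w => w - ⟪x, w⟫ • x) t =
      charFun (stdGaussian (EuclideanSpace ℝ (Fin (d + 1)))) (t - ⟪x, t⟫ • x) := by
    rw [charFun_apply, charFun_apply, integral_map m1.aemeasurable (by fun_prop)]
    congr with w
    simp only [inner_sub_left, inner_sub_right, inner_smul_left, inner_smul_right]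
    simp [real_inner_comm, mul_comm]
  have h2 : charFun ((gaussianReal 0 v).map fun g : ℝ => g • x) t =
      charFun (gaussianReal 0 v) ⟪x, t⟫ := by
    rw [charFun_apply, charFun_apply, integral_map m2.aemeasurable (by fun_prop)]
    congr with w
    simp [inner_smul_left, mul_comm]
  rw [h1, h2, charFun_stdGaussian, charFun_gaussianReal, ← Complex.exp_add]
  have e1 : ‖t - ⟪x, t⟫ • x‖ ^ 2 = ⟪t, t⟫ - ⟪x, t⟫ ^ 2 := by
    rw [← real_inner_self_eq_norm_sq]
    simp only [inner_sub_left, inner_sub_right, inner_smul_left, inner_smul_right, hxx,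
      real_inner_comm x t]
    simp
    ring
  have e2 : t.ofLp ⬝ᵥ (spikedCov (1 - v) x.ofLp *ᵥ t.ofLp) =
      ⟪t, t⟫ - (1 - v) * ⟪x, t⟫ ^ 2 := by
    rw [dotProduct_spikedCov_mulVec, EuclideanSpace.inner_eq_star_dotProduct,
      EuclideanSpace.inner_eq_star_dotProduct]
    simp [dotProduct_comm]
  rw [e2, ← Complex.ofReal_pow, e1]
  congr 1
  push_cast
  simp
  ring

/-- Both Gaussians share the component orthogonal to `x` and differ only in the variance along `x`,
so the one-dimensional comparison transfers through the convolution. -/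
lemma multivariateGaussian_spikedCov_le {θ : ℝ} (hθ : θ ∈ Set.Ioo (0 : ℝ) 1)
    {x : Fin (d + 1) → ℝ} (hx : x ⬝ᵥ x = 1) :
    multivariateGaussian 0 (spikedCov θ x) ≤
      ENNReal.ofReal (√(1 - θ))⁻¹ • multivariateGaussian 0 (1 : Matrix _ _ ℝ) := by
  have hθ' : (0 : ℝ) ≤ 1 - θ := by linarith [hθ.2]
  obtain ⟨v, hv⟩ : ∃ v : NNReal, (v : ℝ) = 1 - θ := ⟨⟨1 - θ, hθ'⟩, rfl⟩
  have hv0 : v ≠ 0 := by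
    rintro rfl
    simp at hv
    linarith [hθ.2]
  have hv1 : v ≤ 1 := by
    rw [← NNReal.coe_le_coe, hv]
    simpa using hθ.1.le
  have e1 := multivariateGaussian_spikedCov_eq_conv (x := toLp 2 x) hx v hv1
  have e2 := multivariateGaussian_spikedCov_eq_conv (x := toLp 2 x) hx 1 le_rfl
  have e3 : spikedCov (1 - ((1 : NNReal) : ℝ)) (toLp 2 x).ofLp = 1 := by simp [spikedCov]
  have e4 : (1 : ℝ) - (v : ℝ) = θ := by rw [hv]; ring
  rw [e4] at e1
  rw [e3] at e2
  change multivariateGaussian 0 (spikedCov θ (toLp 2 x).ofLp) ≤ _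
  rw [e1, e2, ← hv, Measure.conv, Measure.conv, ← Measure.map_smul]
  refine Measure.map_mono ?_ (by fun_prop)
  rw [← Measure.prod_smul_right]
  refine Measure.prod_mono le_rfl ?_
  rw [← Measure.map_smul]
  exact Measure.map_mono (gaussianReal_le_smul hv0 hv1) (by fun_prop)

lemma spike_dotProduct_spike (d k : ℕ) (s s' : Fin d → SignType) :
    spike d k s ⬝ᵥ spike d k s' =
      (1 + ∑ i, ((s i : SignType) : ℝ) * ((s' i : SignType) : ℝ)) / ((k : ℝ) + 1) := by
  have h : √((k : ℝ) + 1) * √((k : ℝ) + 1) = (k : ℝ) + 1 :=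
    Real.mul_self_sqrt (by positivity)
  simp only [spike, dotProduct, Fin.sum_univ_succ, Fin.cons_zero, Fin.cons_succ, div_mul_div_comm,
    h, add_div, Finset.sum_div]
  norm_num

lemma spike_dotProduct_self {d k : ℕ} {s : Fin d → SignType} (hs : s ∈ signPatterns d k) :
    spike d k s ⬝ᵥ spike d k s = 1 := by
  have h1 : ∀ i, ((s i : SignType) : ℝ) * ((s i : SignType) : ℝ) = if s i ≠ 0 then 1 else 0 := by
    intro i
    rcases h : s i <;> simp
  have h2 : (Finset.univ.filter fun i => s i ≠ 0).card = k := by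
    simpa [signPatterns] using hs
  rw [spike_dotProduct_spike, Finset.sum_congr rfl fun i _ => h1 i, Finset.sum_boole, h2, add_comm,
    div_self (by positivity)]

instance isProbabilityMeasure_null (d n : ℕ) : IsProbabilityMeasure (null d n) := by
  unfold null; infer_instance

/-- Used only qualitatively, for absolute continuity and integrability: the constant may blow up
with `n` and `θ`. -/
lemma planted_le_smul_null {θ : ℝ} (hθ : θ ∈ Set.Ioo (0 : ℝ) 1) (d k n : ℕ) :
    ∃ C : ℝ≥0∞, C ≠ ∞ ∧ planted θ d k n ≤ C • null d n := by
  set c : ℝ≥0∞ := ENNReal.ofReal (√(1 - θ))⁻¹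
  have hc : c ≠ ∞ := ENNReal.ofReal_ne_top
  have hc0 : c ≠ 0 := by
    have : 0 < √(1 - θ) := Real.sqrt_pos.2 (by linarith [hθ.2])
    simpa [c] using this
  refine ⟨c ^ n, ENNReal.pow_ne_top hc, ?_⟩
  have h : ∑ s ∈ signPatterns d k,
      Measure.pi (fun _ : Fin n => multivariateGaussian 0 (spikedCov θ (spike d k s))) ≤
      ∑ _s ∈ signPatterns d k, c ^ n • null d n := by
    refine Finset.sum_le_sum fun s hs => ?_
    have := measure_pi_le_smul_pi (ι := Fin n)
      (μ := fun _ => multivariateGaussian 0 (spikedCov θ (spike d k s)))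
      (ν := fun _ => multivariateGaussian 0 1) hc0 hc
      fun _ => multivariateGaussian_spikedCov_le hθ (spike_dotProduct_self hs)
    simpa [null] using this
  refine Measure.le_iff'.2 fun A => ?_
  have hA := Measure.le_iff'.1 h A
  rw [planted, Measure.smul_apply, smul_eq_mul]
  refine (mul_le_mul_right hA _).trans ?_
  simp only [Finset.sum_const, Measure.smul_apply, nsmul_eq_mul, smul_eq_mul]
  rw [← mul_assoc]
  refine mul_le_of_le_one_left (by positivity) (ENNReal.inv_mul_le_one _)

lemma signPatterns_nonempty {d k : ℕ} (hkd : k ≤ d) : (signPatterns d k).Nonempty := by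
  obtain ⟨U, -, hU⟩ := Finset.exists_subset_card_eq
    (show k ≤ (Finset.univ : Finset (Fin d)).card by simpa using hkd)
  refine ⟨fun i => if i ∈ U then 1 else 0, ?_⟩
  simpa [signPatterns] using hU

lemma isProbabilityMeasure_planted (θ : ℝ) {d k : ℕ} (hkd : k ≤ d) (n : ℕ) :
    IsProbabilityMeasure (planted θ d k n) := by
  constructor
  have h0 : ((signPatterns d k).card : ℝ≥0∞) ≠ 0 := by
    simpa using (signPatterns_nonempty hkd).ne_empty
  simp [planted, ENNReal.inv_mul_cancel h0]

lemma planted_absolutelyContinuous {θ : ℝ} (hθ : θ ∈ Set.Ioo (0 : ℝ) 1) (d k n : ℕ) :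
    planted θ d k n ≪ null d n := by
  obtain ⟨C, -, h⟩ := planted_le_smul_null hθ d k n
  exact Measure.absolutelyContinuous_of_le_smul h

lemma memLp_likelihoodRatio {θ : ℝ} (hθ : θ ∈ Set.Ioo (0 : ℝ) 1) (d k n : ℕ) :
    MemLp (likelihoodRatio (planted θ d k n) (null d n)) 2 (null d n) := by
  obtain ⟨C, hC, h⟩ := planted_le_smul_null hθ d k n
  have hle : (planted θ d k n).rnDeriv (null d n) ≤ᵐ[null d n] fun _ => C := by
    refine ae_le_of_forall_setLIntegral_le_of_sigmaFinite (Measure.measurable_rnDeriv _ _)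
      fun s hs _ => ?_
    refine (Measure.setLIntegral_rnDeriv_le s).trans ?_
    simpa using Measure.le_iff'.1 h s
  refine MemLp.of_bound (C := C.toReal) ?_ ?_
  · exact (Measure.measurable_rnDeriv _ _).ennreal_toReal.aestronglyMeasurable
  · filter_upwards [hle] with z hz
    rw [likelihoodRatio, Real.norm_of_nonneg ENNReal.toReal_nonneg]
    exact ENNReal.toReal_mono hC hz

end Domination

/-! ### Gaussian integration by parts for polynomials -/

section Stein

open MvPolynomial WithLp

variable {ι : Type*} [Fintype ι]

lemma integrable_eval_mvPolynomial {μ : Measure (EuclideanSpace ℝ ι)} [IsGaussian μ]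
    (p : MvPolynomial ι ℝ) : Integrable (fun z => eval z.ofLp p) μ := by
  simp_rw [eval_eq]
  refine integrable_finsetSum _ fun a _ => Integrable.const_mul ?_ _
  have hm : MemLp (fun z : EuclideanSpace ℝ ι => z) (∑ i, a i : ℕ) μ :=
    IsGaussian.memLp_id μ _ (by simp)
  refine hm.integrable_norm_pow'.mono' (by fun_prop) (ae_of_all _ fun z => ?_)
  have hsub : ∏ i ∈ a.support, z.ofLp i ^ a i = ∏ i, z.ofLp i ^ a i :=
    Finset.prod_subset (Finset.subset_univ _) fun i _ hi => by
      simp [Finsupp.notMem_support_iff.1 hi]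
  simp only [hsub, norm_prod, norm_pow, ← Finset.prod_pow_eq_pow_sum]
  gcongr with i
  exact PiLp.norm_apply_le z i

lemma integrable_eval_gaussianReal (g : Polynomial ℝ) :
    Integrable (fun x => g.eval x) (gaussianReal 0 1) := by
  simp_rw [Polynomial.eval_eq_sum_range]
  refine integrable_finsetSum _ fun a _ => Integrable.const_mul ?_ _
  have hm : MemLp (fun x : ℝ => x) (a : ℕ) (gaussianReal 0 1) :=
    IsGaussian.memLp_id _ _ (by simp)
  exact hm.integrable_norm_pow'.mono' (by fun_prop) (ae_of_all _ fun z => by simp)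

/-- The derivative of density times `g` is the density times `g' - x g`, and an integrable function
with integrable derivative has a derivative of integral zero. -/
lemma stein_gaussianReal (g : Polynomial ℝ) :
    ∫ x, x * g.eval x ∂(gaussianReal 0 1) = ∫ x, g.derivative.eval x ∂(gaussianReal 0 1) := by
  have hI : ∀ q : Polynomial ℝ, Integrable (fun x => gaussianPDFReal 0 1 x * q.eval x) := by
    intro q
    have := integrable_eval_gaussianReal q
    rw [gaussianReal_of_var_ne_zero _ one_ne_zero, gaussianPDF_def,
      integrable_withDensity_iff_integrable_smul' (by fun_prop) (by simp)] at this
    refine this.congr (ae_of_all _ fun x => ?_)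
    simp [ENNReal.toReal_ofReal (gaussianPDFReal_nonneg 0 1 x)]
  have hd : ∀ x : ℝ, HasDerivAt (fun x => gaussianPDFReal 0 1 x * g.eval x)
      (gaussianPDFReal 0 1 x * (g.derivative - Polynomial.X * g).eval x) x := by
    intro x
    have h1 : HasDerivAt (gaussianPDFReal 0 1) (gaussianPDFReal 0 1 x * -x) x := by
      have h2 : HasDerivAt (fun x : ℝ => -(x - 0) ^ 2 / (2 * (1 : NNReal))) (-x) x :=
        (((((hasDerivAt_id' x).sub_const 0).fun_pow 2).fun_neg).div_const _).congr_deriv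
          (by simp; ring)
      exact ((h2.exp).const_mul ((√(2 * Real.pi * (1 : NNReal)))⁻¹)).congr_deriv
        (by rw [gaussianPDFReal]; ring)
    refine (h1.mul (g.hasDerivAt x)).congr_deriv ?_
    rw [Polynomial.eval_sub, Polynomial.eval_mul, Polynomial.eval_X]
    ring
  have h0 := integral_eq_zero_of_hasDerivAt_of_integrable hd (hI _) (hI _)
  rw [integral_gaussianReal_eq_integral_smul one_ne_zero,
    integral_gaussianReal_eq_integral_smul one_ne_zero, ← sub_eq_zero, ← neg_eq_zero, neg_sub]
  simp only [smul_eq_mul]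
  rw [← integral_sub (hI _) ((hI (Polynomial.X * g)).congr (ae_of_all _ fun x => by simp))]
  refine Eq.trans ?_ h0
  refine integral_congr_ae (ae_of_all _ fun x => ?_)
  simp only [Polynomial.eval_sub, Polynomial.eval_mul, Polynomial.eval_X]
  ring

lemma integrable_eval_pi_gaussianReal (p : MvPolynomial ι ℝ) :
    Integrable (fun z => eval z p) (Measure.pi fun _ : ι => gaussianReal 0 1) := by
  have h : Integrable (fun z : EuclideanSpace ℝ ι => eval z.ofLp p)
      ((Measure.pi fun _ : ι => gaussianReal 0 1).map (toLp 2)) := by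
    rw [map_pi_eq_stdGaussian]
    exact integrable_eval_mvPolynomial p
  exact h.comp_measurable (by fun_prop)

lemma eval_monomial_fintype (a : ι →₀ ℕ) (c : ℝ) (z : ι → ℝ) :
    eval z (monomial a c) = c * ∏ i, z i ^ a i := by
  rw [eval_monomial, Finsupp.prod_fintype _ _ (by simp)]

lemma stein_pi_gaussianReal (p : MvPolynomial ι ℝ) (j : ι) :
    ∫ z, z j * eval z p ∂(Measure.pi fun _ : ι => gaussianReal 0 1) =
      ∫ z, eval z (pderiv j p) ∂(Measure.pi fun _ : ι => gaussianReal 0 1) := by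
  classical
  induction p using MvPolynomial.induction_on' with
  | monomial a c =>
    have e1 : ∀ z : ι → ℝ, z j * eval z (monomial a c) =
        c * ∏ i, (if i = j then z i * z i ^ a i else z i ^ a i) := by
      intro z
      rw [eval_monomial_fintype, ← Finset.mul_prod_erase _ _ (Finset.mem_univ j),
        ← Finset.mul_prod_erase _ (fun i => if i = j then _ else _) (Finset.mem_univ j), if_pos rfl,
        Finset.prod_congr rfl fun i hi => if_neg (Finset.ne_of_mem_erase hi)]
      ring
    have e2 : ∀ z : ι → ℝ, eval z (pderiv j (monomial a c)) =
        c * ∏ i, (if i = j then (a i : ℝ) * z i ^ (a i - 1) else z i ^ a i) := by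
      intro z
      rw [pderiv_monomial, eval_monomial_fintype,
        ← Finset.mul_prod_erase _ _ (Finset.mem_univ j),
        ← Finset.mul_prod_erase _ (fun i => if i = j then _ else _) (Finset.mem_univ j), if_pos rfl,
        Finset.prod_congr rfl fun i hi => if_neg (Finset.ne_of_mem_erase hi)]
      have : ∀ i ∈ Finset.univ.erase j,
          z i ^ (a - Finsupp.single j 1 : ι →₀ ℕ) i = z i ^ a i := fun i hi => by
        simp [Finset.ne_of_mem_erase hi]
      rw [Finset.prod_congr rfl this]
      simp
      ring
    simp_rw [e1, e2, integral_const_mul]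
    rw [integral_fintype_prod_eq_prod (fun i x => if i = j then x * x ^ a i else x ^ a i),
      integral_fintype_prod_eq_prod
        (fun i x => if i = j then (a i : ℝ) * x ^ (a i - 1) else x ^ a i)]
    congr 1
    refine Finset.prod_congr rfl fun i _ => ?_
    split_ifs with h
    · have h := stein_gaussianReal (Polynomial.X ^ a i)
      simp only [Polynomial.eval_pow, Polynomial.eval_X, Polynomial.derivative_X_pow,
        Polynomial.eval_mul, Polynomial.eval_C] at h
      exact h
    · rfl
  | add p q hp hq =>
    have hX : ∀ p : MvPolynomial ι ℝ, Integrable (fun z => z j * eval z p)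
        (Measure.pi fun _ : ι => gaussianReal 0 1) := fun p =>
      (integrable_eval_pi_gaussianReal (X j * p)).congr (ae_of_all _ fun z => by simp)
    simp only [map_add, mul_add]
    rw [integral_add (hX p) (hX q), hp, hq, integral_add (integrable_eval_pi_gaussianReal _)
      (integrable_eval_pi_gaussianReal _)]

lemma pderiv_bind₁ {κ : Type*} (L : ι → MvPolynomial κ ℝ) (p : MvPolynomial ι ℝ) (l : κ) :
    pderiv l (bind₁ L p) = ∑ m, bind₁ L (pderiv m p) * pderiv l (L m) := by
  classical
  induction p using MvPolynomial.induction_on with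
  | C a => simp
  | add p q hp hq => simp [hp, hq, add_mul, Finset.sum_add_distrib]
  | mul_X p i hp =>
    simp only [map_mul, Derivation.leibniz, hp, bind₁_X_right, smul_eq_mul, map_add, pderiv_X,
      add_mul, Finset.sum_add_distrib, Finset.mul_sum]
    congr 1
    · rw [Finset.sum_eq_single i]
      · simp
      · intro m _ hm
        simp [hm.symm]
      · simp
    · exact Finset.sum_congr rfl fun m _ => by ring

variable [DecidableEq ι]

open scoped MatrixOrder in
/-- Stein's identity for centred Gaussian vectors and polynomials. -/
lemma stein_multivariateGaussian {S : Matrix ι ι ℝ} (hS : S.PosSemidef) (p : MvPolynomial ι ℝ)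
    (j : ι) :
    ∫ z, z j * eval z.ofLp p ∂(multivariateGaussian 0 S) =
      ∑ m, S j m * ∫ z, eval z.ofLp (pderiv m p) ∂(multivariateGaussian 0 S) := by
  -- A vector of covariance `S` is `A w` with `w` standard Gaussian. The standard identity and the
  -- chain rule produce `A` twice, and `A * A = S`; no invertibility is needed.
  set A := CFC.sqrt S
  have hAA : A * A = S := CFC.sqrt_mul_sqrt_self _ hS.nonneg
  have hAt : ∀ i j, A i j = A j i := fun i j => by
    have h : A.IsHermitian := (CFC.sqrt_nonneg S).isSelfAdjoint
    simpa using (h.apply i j).symm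
  set L : ι → MvPolynomial ι ℝ := fun m => ∑ l, C (A m l) * X l
  have hmap : multivariateGaussian 0 S =
      (Measure.pi fun _ : ι => gaussianReal 0 1).map
        fun w => Matrix.toEuclideanCLM (𝕜 := ℝ) A (toLp 2 w) := by
    rw [multivariateGaussian, ← map_pi_eq_stdGaussian, Measure.map_map (by fun_prop) (by fun_prop)]
    congr 1
    ext w
    simp [A]
  have hint : ∀ q : MvPolynomial ι ℝ, ∫ z, eval z.ofLp q ∂(multivariateGaussian 0 S) =
      ∫ w, eval w (bind₁ L q) ∂(Measure.pi fun _ : ι => gaussianReal 0 1) := by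
    intro q
    have hc : Continuous fun z : EuclideanSpace ℝ ι => eval z.ofLp q :=
      (MvPolynomial.continuous_eval q).comp (PiLp.continuous_ofLp 2 _)
    rw [hmap, integral_map (by fun_prop) hc.aestronglyMeasurable]
    congr with w
    rw [← coe_aeval_eq_eval, ← coe_aeval_eq_eval, RingHom.coe_coe, RingHom.coe_coe, aeval_bind₁]
    congr
    ext m
    simp [L, Matrix.mulVec, dotProduct]
  have hpd : ∀ l m, pderiv l (L m) = C (A m l) := by
    intro l m
    simp [L, Derivation.leibniz, pderiv_X, Pi.single_apply]
  have h1 : ∫ z, z j * eval z.ofLp p ∂(multivariateGaussian 0 S) =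
      ∑ l, A j l * ∫ w, w l * eval w (bind₁ L p)
        ∂(Measure.pi fun _ : ι => gaussianReal 0 1) := by
    have := hint (X j * p)
    simp only [map_mul, eval_X, bind₁_X_right] at this
    rw [this]
    simp only [← integral_const_mul]
    rw [← integral_finsetSum]
    · congr with w
      simp [L, Finset.sum_mul, mul_assoc]
    · intro l _
      exact (integrable_eval_pi_gaussianReal (C (A j l) * (X l * bind₁ L p))).congr
        (ae_of_all _ fun z => by simp)
  rw [h1]
  have h2 : ∀ l, ∫ w, w l * eval w (bind₁ L p) ∂(Measure.pi fun _ : ι => gaussianReal 0 1) =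
      ∑ m, A m l * ∫ z, eval z.ofLp (pderiv m p) ∂(multivariateGaussian 0 S) := by
    intro l
    rw [stein_pi_gaussianReal, pderiv_bind₁]
    simp only [hint, ← integral_const_mul]
    rw [← integral_finsetSum]
    · congr with w
      simp [hpd, mul_comm]
    · intro m _
      exact (integrable_eval_pi_gaussianReal (C (A m l) * bind₁ L (pderiv m p))).congr
        (ae_of_all _ fun z => by simp)
  simp_rw [h2, Finset.mul_sum]
  rw [Finset.sum_comm]
  refine Finset.sum_congr rfl fun m _ => ?_
  rw [← hAA, Matrix.mul_apply, Finset.sum_mul]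
  exact Finset.sum_congr rfl fun l _ => by rw [hAt m l]; ring

end Stein

/-! ### Multivariate Hermite polynomials and their span -/

section Hermite

open MvPolynomial WithLp

lemma derivative_hermite_succ (n : ℕ) :
    (Polynomial.hermite (n + 1)).derivative = ((n : ℤ) + 1) • Polynomial.hermite n := by
  induction n with
  | zero => simp
  | succ n ih =>
    rw [Polynomial.hermite_succ (n + 1), Polynomial.derivative_sub, Polynomial.derivative_mul,
      ih, Polynomial.derivative_smul, Polynomial.hermite_succ n]
    simp only [Polynomial.derivative_X, Nat.cast_add, Nat.cast_one, zsmul_eq_mul, Int.cast_add,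
      Int.cast_natCast, Int.cast_one]
    ring

/-- The probabilists' Hermite polynomials with real coefficients. -/
def hermiteReal (n : ℕ) : Polynomial ℝ := (Polynomial.hermite n).map (Int.castRingHom ℝ)

lemma hermiteReal_zero : hermiteReal 0 = 1 := by simp [hermiteReal]

lemma hermiteReal_succ (n : ℕ) :
    hermiteReal (n + 1) = Polynomial.X * hermiteReal n - (hermiteReal n).derivative := by
  simp [hermiteReal, Polynomial.hermite_succ, Polynomial.derivative_map]

lemma derivative_hermiteReal (n : ℕ) :
    (hermiteReal n).derivative = (n : ℝ) • hermiteReal (n - 1) := by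
  cases n with
  | zero => simp [hermiteReal]
  | succ n =>
    rw [hermiteReal, Polynomial.derivative_map, derivative_hermite_succ]
    simp [hermiteReal, Polynomial.smul_eq_C_mul]

lemma pderiv_aeval_X {ι : Type*} [DecidableEq ι] (i j : ι) (q : Polynomial ℝ) :
    pderiv j (Polynomial.aeval (X i : MvPolynomial ι ℝ) q) =
      if i = j then Polynomial.aeval (X i : MvPolynomial ι ℝ) q.derivative else 0 := by
  rw [Derivation.map_aeval, pderiv_X]
  split_ifs with h
  · subst h; simp
  · simp [h]

lemma sub_single_add_single {ι : Type*} [DecidableEq ι] {a : ι → ℕ} {j : ι} (hj : a j ≠ 0) :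
    a - Pi.single j 1 + Pi.single j 1 = a := by
  ext i
  by_cases h : i = j
  · subst h; simp; omega
  · simp [h]

lemma prod_pow_add_single {ι : Type*} [Fintype ι] [DecidableEq ι] (x : ι → ℝ) (b : ι → ℕ)
    (j : ι) : ∏ i, x i ^ (b + Pi.single j 1 : ι → ℕ) i = x j * ∏ i, x i ^ b i := by
  have : ∀ i, x i ^ (b + Pi.single j 1 : ι → ℕ) i = (if i = j then x i else 1) * x i ^ b i := by
    intro i
    split_ifs with h
    · subst h; rw [Pi.add_apply, Pi.single_eq_same, pow_succ, mul_comm]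
    · simp [h]
  rw [Finset.prod_congr rfl fun i _ => this i, Finset.prod_mul_distrib]
  simp

lemma pderiv_prod_aeval_X {ι : Type*} [DecidableEq ι] (q : ι → Polynomial ℝ) {s : Finset ι}
    {j : ι} (hj : j ∉ s) :
    pderiv j (∏ i ∈ s, Polynomial.aeval (X i : MvPolynomial ι ℝ) (q i)) = 0 := by
  induction s using Finset.induction_on with
  | empty => simp
  | insert i s hi ih =>
    rw [Finset.mem_insert, not_or] at hj
    rw [Finset.prod_insert hi, Derivation.leibniz, ih hj.2, pderiv_aeval_X, if_neg (Ne.symm hj.1)]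
    simp

variable {ι : Type*} [Fintype ι]

/-- The Hermite polynomial of multi-index `a`. -/
def hermiteMv (a : ι → ℕ) : MvPolynomial ι ℝ :=
  ∏ i, Polynomial.aeval (X i : MvPolynomial ι ℝ) (hermiteReal (a i))

lemma eval_hermiteMv (a : ι → ℕ) (z : ι → ℝ) :
    eval z (hermiteMv a) = ∏ i, (hermiteReal (a i)).eval (z i) := by
  rw [hermiteMv, map_prod]
  refine Finset.prod_congr rfl fun i _ => ?_
  rw [← coe_aeval_eq_eval, RingHom.coe_coe, ← Polynomial.aeval_algHom_apply, aeval_X,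
    Polynomial.coe_aeval_eq_eval]

lemma hermiteMv_zero : hermiteMv (0 : ι → ℕ) = 1 := by simp [hermiteMv, hermiteReal_zero]

variable [DecidableEq ι]

lemma hermiteMv_eq_mul_prod (a : ι → ℕ) (j : ι) :
    hermiteMv a = Polynomial.aeval (X j : MvPolynomial ι ℝ) (hermiteReal (a j)) *
      ∏ i ∈ Finset.univ.erase j, Polynomial.aeval (X i : MvPolynomial ι ℝ) (hermiteReal (a i)) :=
  (Finset.mul_prod_erase _ _ (Finset.mem_univ j)).symm

lemma pderiv_hermiteMv_eq (a : ι → ℕ) (j : ι) :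
    pderiv j (hermiteMv a) =
      Polynomial.aeval (X j : MvPolynomial ι ℝ) (hermiteReal (a j)).derivative *
      ∏ i ∈ Finset.univ.erase j,
        Polynomial.aeval (X i : MvPolynomial ι ℝ) (hermiteReal (a i)) := by
  rw [hermiteMv_eq_mul_prod a j, Derivation.leibniz, 
    pderiv_prod_aeval_X _ (Finset.notMem_erase j _), smul_zero, zero_add,
    pderiv_aeval_X, if_pos rfl, smul_eq_mul, mul_comm]

/-- The truncated subtraction is harmless: when `a j = 0` the coefficient vanishes. -/
lemma pderiv_hermiteMv (a : ι → ℕ) (j : ι) :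
    pderiv j (hermiteMv a) = (a j : ℝ) • hermiteMv (a - Pi.single j 1) := by
  rw [pderiv_hermiteMv_eq, derivative_hermiteReal, hermiteMv_eq_mul_prod (a - Pi.single j 1) j,
    map_smul, smul_mul_assoc]
  congr 2
  · simp
  · refine Finset.prod_congr rfl fun i hi => ?_
    simp [Finset.ne_of_mem_erase hi]

lemma hermiteMv_add_single (a : ι → ℕ) (j : ι) :
    hermiteMv (a + Pi.single j 1) = X j * hermiteMv a - pderiv j (hermiteMv a) := by
  rw [pderiv_hermiteMv_eq, hermiteMv_eq_mul_prod (a + Pi.single j 1) j,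
    hermiteMv_eq_mul_prod a j]
  have h1 : (a + Pi.single j 1 : ι → ℕ) j = a j + 1 := by simp
  have h2 : ∀ i ∈ Finset.univ.erase j,
      Polynomial.aeval (X i : MvPolynomial ι ℝ) (hermiteReal ((a + Pi.single j 1 : ι → ℕ) i)) =
      Polynomial.aeval (X i : MvPolynomial ι ℝ) (hermiteReal (a i)) := fun i hi => by
    simp [Finset.ne_of_mem_erase hi]
  rw [h1, Finset.prod_congr rfl h2, hermiteReal_succ, map_sub, map_mul, Polynomial.aeval_X]
  ring

/-- The multi-indices of order at most `D`. -/
def multiIndices (ι : Type*) [Fintype ι] [DecidableEq ι] (D : ℕ) : Finset (ι → ℕ) :=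
  (Fintype.piFinset fun _ => Finset.range (D + 1)).filter fun a => ∑ i, a i ≤ D

lemma mem_multiIndices {D : ℕ} {a : ι → ℕ} : a ∈ multiIndices ι D ↔ ∑ i, a i ≤ D := by
  simp only [multiIndices, Finset.mem_filter, Fintype.mem_piFinset, Finset.mem_range,
    and_iff_right_iff_imp]
  intro h i
  exact Nat.lt_succ_of_le ((Finset.single_le_sum (fun _ _ => Nat.zero_le _)
    (Finset.mem_univ i)).trans h)

/-- This is the three-term recurrence `x_j H_a = H_{a+e_j} + a_j H_{a-e_j}`, which raises the order
by at most one. -/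
lemma X_mul_mem_span_hermiteMv {D : ℕ} (j : ι) {p : MvPolynomial ι ℝ}
    (hp : p ∈ Submodule.span ℝ (hermiteMv '' (multiIndices ι D : Set (ι → ℕ)))) :
    X j * p ∈ Submodule.span ℝ (hermiteMv '' (multiIndices ι (D + 1) : Set (ι → ℕ))) := by
  induction hp using Submodule.span_induction with
  | mem p hp =>
    obtain ⟨a, ha, rfl⟩ := hp
    have ha' : ∑ i, a i ≤ D := mem_multiIndices.1 ha
    have h : X j * hermiteMv a =
        hermiteMv (a + Pi.single j 1) + (a j : ℝ) • hermiteMv (a - Pi.single j 1) := by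
      rw [hermiteMv_add_single, pderiv_hermiteMv]; ring
    rw [h]
    refine Submodule.add_mem _ (Submodule.subset_span ⟨_, ?_, rfl⟩)
      (Submodule.smul_mem _ _ (Submodule.subset_span ⟨_, ?_, rfl⟩))
    · refine mem_multiIndices.2 ?_
      simp [Finset.sum_add_distrib, ha']
    · refine mem_multiIndices.2 (le_trans (Finset.sum_le_sum fun i _ => ?_) (ha'.trans D.le_succ))
      exact Nat.sub_le _ _
  | zero => simp
  | add p q _ _ hp hq => rw [mul_add]; exact Submodule.add_mem _ hp hq
  | smul c p _ hp => rw [mul_smul_comm]; exact Submodule.smul_mem _ _ hp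

lemma multiIndices_mono {D E : ℕ} (h : D ≤ E) : multiIndices ι D ⊆ multiIndices ι E :=
  fun _ ha => mem_multiIndices.2 ((mem_multiIndices.1 ha).trans h)

lemma monomial_mem_span_hermiteMv (D : ℕ) (m : ι →₀ ℕ) (hm : m.degree = D) :
    monomial m (1 : ℝ) ∈ Submodule.span ℝ (hermiteMv '' (multiIndices ι D : Set (ι → ℕ))) := by
  induction D generalizing m with
  | zero =>
    rw [Finsupp.degree_eq_zero_iff] at hm
    subst hm
    refine Submodule.subset_span ⟨0, mem_multiIndices.2 (by simp), ?_⟩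
    rw [hermiteMv_zero]; rfl
  | succ D ih =>
    obtain ⟨j, hj⟩ : ∃ j, m j ≠ 0 := by
      by_contra! h
      have : m = 0 := Finsupp.ext h
      simp [this] at hm
    have hle : Finsupp.single j 1 ≤ m := by
      simpa [Finsupp.single_le_iff] using Nat.one_le_iff_ne_zero.2 hj
    have hsplit : m = Finsupp.single j 1 + (m - Finsupp.single j 1) :=
      (add_tsub_cancel_of_le hle).symm
    have hdeg : (m - Finsupp.single j 1).degree = D := by
      have h := congrArg Finsupp.degree hsplit
      rw [map_add, hm, Finsupp.degree_single] at h
      omega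
    have : monomial m (1 : ℝ) = X j * monomial (m - Finsupp.single j 1) 1 := by
      rw [X, monomial_mul, ← hsplit, one_mul]
    rw [this]
    exact X_mul_mem_span_hermiteMv j (ih _ hdeg)

lemma exists_eq_sum_hermiteMv {D : ℕ} {f : MvPolynomial ι ℝ} (hf : f.totalDegree ≤ D) :
    ∃ c : (ι → ℕ) → ℝ, f = ∑ a ∈ multiIndices ι D, c a • hermiteMv a := by
  have h : f ∈ Submodule.span ℝ (hermiteMv '' (multiIndices ι D : Set (ι → ℕ))) := by
    rw [f.as_sum]
    refine Submodule.sum_mem _ fun m hm => ?_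
    have : monomial m (coeff m f) = coeff m f • monomial m (1 : ℝ) := by
      rw [smul_monomial, smul_eq_mul, mul_one]
    rw [this]
    refine Submodule.smul_mem _ _ ?_
    have hdeg : m.degree ≤ D := (le_totalDegree hm).trans hf
    exact Submodule.span_mono (Set.image_mono (by exact_mod_cast multiIndices_mono hdeg))
      (monomial_mem_span_hermiteMv _ m rfl)
  obtain ⟨c, hc⟩ := (Submodule.mem_span_image_finset_iff_exists_fun' ℝ).1 h
  exact ⟨c, hc.symm⟩

end Hermite

/-! ### Hermite expectations under spiked and standard Gaussians -/

section GaussianHermite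

open MvPolynomial WithLp Matrix

variable {ι : Type*} [Fintype ι] [DecidableEq ι]

/-- Stein's identity turns `x_j H_a` into derivatives weighted by `S`; the derivative term in
`H_{a+e_j} = x_j H_a - ∂_j H_a` subtracts the identity. -/
lemma integral_hermiteMv_add_single {S : Matrix ι ι ℝ} (hS : S.PosSemidef) (a : ι → ℕ) (j : ι) :
    ∫ z, eval z.ofLp (hermiteMv (a + Pi.single j 1)) ∂(multivariateGaussian 0 S) =
      ∑ m, (S j m - (1 : Matrix ι ι ℝ) j m) * (a m *
        ∫ z, eval z.ofLp (hermiteMv (a - Pi.single m 1)) ∂(multivariateGaussian 0 S)) := by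
  have hI := fun p : MvPolynomial ι ℝ =>
    integrable_eval_mvPolynomial (μ := multivariateGaussian 0 S) p
  have hp : ∀ m, ∫ z, eval z.ofLp (pderiv m (hermiteMv a)) ∂(multivariateGaussian 0 S) =
      a m * ∫ z, eval z.ofLp (hermiteMv (a - Pi.single m 1)) ∂(multivariateGaussian 0 S) := by
    intro m
    simp only [pderiv_hermiteMv, smul_eval, integral_const_mul]
  have h1 : ∫ z, eval z.ofLp (hermiteMv (a + Pi.single j 1)) ∂(multivariateGaussian 0 S) =
      ∫ z, z j * eval z.ofLp (hermiteMv a) ∂(multivariateGaussian 0 S) -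
        ∫ z, eval z.ofLp (pderiv j (hermiteMv a)) ∂(multivariateGaussian 0 S) := by
    rw [← integral_sub _ (hI _)]
    · refine integral_congr_ae (ae_of_all _ fun z => ?_)
      simp [hermiteMv_add_single]
    · exact (hI (X j * hermiteMv a)).congr (ae_of_all _ fun z => by simp)
  rw [h1, stein_multivariateGaussian hS]
  simp only [← hp, sub_mul, Finset.sum_sub_distrib]
  congr 1
  simp [Matrix.one_apply]

/-- The expectation of the Hermite polynomials of order `m` under `N(0, Id - θ x xᵀ)`, up to a
power of `x`. -/
def hermiteCoeff (θ : ℝ) : ℕ → ℝ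
  | 0 => 1
  | 1 => 0
  | m + 2 => -θ * (m + 1) * hermiteCoeff θ m

lemma hermiteCoeff_succ (θ : ℝ) (m : ℕ) :
    hermiteCoeff θ (m + 1) = -θ * m * hermiteCoeff θ (m - 1) := by
  cases m with
  | zero => simp [hermiteCoeff]
  | succ m => simp [hermiteCoeff]

lemma integral_hermiteMv_spiked {d : ℕ} {θ : ℝ} (hθ : θ ∈ Set.Icc (0 : ℝ) 1)
    {x : Fin (d + 1) → ℝ} (hx : x ⬝ᵥ x = 1) (a : Fin (d + 1) → ℕ) :
    ∫ z, eval z.ofLp (hermiteMv a) ∂(multivariateGaussian 0 (spikedCov θ x)) =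
      hermiteCoeff θ (∑ j, a j) * ∏ j, x j ^ a j := by
  induction hN : ∑ j, a j using Nat.strong_induction_on generalizing a with
  | _ N ih =>
    by_cases h0 : a = 0
    · subst h0
      have : N = 0 := by simpa using hN.symm
      simp [this, hermiteMv_zero, hermiteCoeff]
    obtain ⟨j, hj⟩ : ∃ j, a j ≠ 0 := by
      by_contra! h
      exact h0 (funext h)
    set b : Fin (d + 1) → ℕ := a - Pi.single j 1
    have hab : b + Pi.single j 1 = a := sub_single_add_single hj
    have hbN : ∑ i, b i + 1 = N := by
      rw [← hN, ← hab]
      simp [Finset.sum_add_distrib]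
    have hx_a : ∏ i, x i ^ a i = x j * ∏ i, x i ^ b i := by
      rw [← hab, prod_pow_add_single]
    -- The factor `x m` restores the power lost in `b - e_m`. Summing over `m` then produces `∑ b m
    -- = |b|`, the factor in the recursion of `hermiteCoeff`.
    have hterm : ∀ m, (b m : ℝ) * (∫ z, eval z.ofLp (hermiteMv (b - Pi.single m 1))
        ∂(multivariateGaussian 0 (spikedCov θ x))) * x m =
        b m * (hermiteCoeff θ (∑ i, b i - 1) * ∏ i, x i ^ b i) := by
      intro m
      by_cases hm : b m = 0
      · simp [hm]
      · have hb' : b - Pi.single m 1 + Pi.single m 1 = b := sub_single_add_single hm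
        have hsum : ∑ i, (b - Pi.single m 1 : Fin (d + 1) → ℕ) i + 1 = ∑ i, b i := by
          conv_rhs => rw [← hb']
          simp [Finset.sum_add_distrib]
        have hprod : ∏ i, x i ^ b i =
            x m * ∏ i, x i ^ (b - Pi.single m 1 : Fin (d + 1) → ℕ) i := by
          conv_lhs => rw [← hb', prod_pow_add_single]
        rw [ih _ (by omega) _ rfl, hprod, ← hsum, Nat.add_sub_cancel]
        ring
    conv_lhs => rw [← hab]
    rw [integral_hermiteMv_add_single (spikedCov_posSemidef hθ hx), ← hbN, hermiteCoeff_succ, hx_a]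
    have hS : ∀ m, spikedCov θ x j m - (1 : Matrix _ _ ℝ) j m = -θ * x j * x m := by
      intro m
      simp [spikedCov, vecMulVec_apply]
      ring
    calc _ = ∑ m, -θ * x j * ((b m : ℝ) * (∫ z, eval z.ofLp (hermiteMv (b - Pi.single m 1))
        ∂(multivariateGaussian 0 (spikedCov θ x))) * x m) := by
          refine Finset.sum_congr rfl fun m _ => ?_
          rw [hS]; ring
      _ = _ := by
          simp_rw [hterm]
          rw [← Finset.mul_sum, ← Finset.sum_mul]
          push_cast
          ring

/-- Raising the index is adjoint to `∂_j` under the standard Gaussian; orthogonality follows by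
moving every raising operator onto the other factor. -/
lemma integral_hermiteMv_add_single_mul (a : ι → ℕ) (j : ι) (p : MvPolynomial ι ℝ) :
    ∫ z, eval z.ofLp (hermiteMv (a + Pi.single j 1) * p) ∂(multivariateGaussian 0 1) =
      ∫ z, eval z.ofLp (hermiteMv a * pderiv j p)
        ∂(multivariateGaussian 0 (1 : Matrix ι ι ℝ)) := by
  have hI := fun p : MvPolynomial ι ℝ =>
    integrable_eval_mvPolynomial (μ := multivariateGaussian 0 (1 : Matrix ι ι ℝ)) p
  have hS := stein_multivariateGaussian (Matrix.PosSemidef.one (n := ι) (R := ℝ)) (hermiteMv a * p) j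
  simp only [Matrix.one_apply, ite_mul, one_mul, zero_mul, Finset.sum_ite_eq, Finset.mem_univ,
    if_true] at hS
  have h1 : ∫ z, eval z.ofLp (hermiteMv (a + Pi.single j 1) * p)
      ∂(multivariateGaussian 0 (1 : Matrix ι ι ℝ)) =
      ∫ z, z j * eval z.ofLp (hermiteMv a * p) ∂(multivariateGaussian 0 (1 : Matrix ι ι ℝ)) -
        ∫ z, eval z.ofLp (pderiv j (hermiteMv a) * p)
          ∂(multivariateGaussian 0 (1 : Matrix ι ι ℝ)) := by
    rw [← integral_sub _ (hI _)]
    · refine integral_congr_ae (ae_of_all _ fun z => ?_)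
      simp only [hermiteMv_add_single, map_mul, map_sub, eval_X]
      ring
    · exact (hI (X j * (hermiteMv a * p))).congr (ae_of_all _ fun z => by simp)
  rw [h1, hS, ← integral_sub (hI _) (hI _)]
  refine integral_congr_ae (ae_of_all _ fun z => ?_)
  simp only [Derivation.leibniz, map_mul, map_add, smul_eq_mul]
  ring

lemma integral_hermiteMv_mul (a b : ι → ℕ) :
    ∫ z, eval z.ofLp (hermiteMv a * hermiteMv b) ∂(multivariateGaussian 0 (1 : Matrix ι ι ℝ)) =
      if a = b then ∏ i, ((a i).factorial : ℝ) else 0 := by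
  induction hN : ∑ j, a j generalizing a b with
  | zero =>
    have ha : a = 0 := by ext i; simpa using (Finset.sum_eq_zero_iff.1 hN) i (Finset.mem_univ i)
    subst ha
    by_cases hb : b = 0
    · subst hb; simp [hermiteMv_zero]
    · obtain ⟨j, hj⟩ : ∃ j, b j ≠ 0 := by
        by_contra! h
        exact hb (funext h)
      rw [if_neg (Ne.symm hb), ← sub_single_add_single hj, mul_comm,
        integral_hermiteMv_add_single_mul, hermiteMv_zero]
      simp
  | succ N ih =>
    obtain ⟨j, hj⟩ : ∃ j, a j ≠ 0 := by
      by_contra! h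
      simp [h] at hN
    set a' : ι → ℕ := a - Pi.single j 1
    have haa : a' + Pi.single j 1 = a := sub_single_add_single hj
    have haN : ∑ i, a' i = N := by
      have : ∑ i, a' i + 1 = N + 1 := by
        rw [← hN, ← haa]
        simp [Finset.sum_add_distrib]
      omega
    rw [← haa, integral_hermiteMv_add_single_mul, pderiv_hermiteMv]
    have : ∫ z, eval z.ofLp (hermiteMv a' * (b j : ℝ) • hermiteMv (b - Pi.single j 1))
        ∂(multivariateGaussian 0 (1 : Matrix ι ι ℝ)) = b j *
        ∫ z, eval z.ofLp (hermiteMv a' * hermiteMv (b - Pi.single j 1))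
          ∂(multivariateGaussian 0 (1 : Matrix ι ι ℝ)) := by
      rw [← integral_const_mul]
      refine integral_congr_ae (ae_of_all _ fun z => ?_)
      simp only [map_mul, smul_eval]
      ring
    rw [this, ih _ _ haN]
    by_cases hb : b j = 0
    · have : a' + Pi.single j 1 ≠ b := by
        rintro rfl
        simp at hb
      simp [hb, this]
    · have hbb : b - Pi.single j 1 + Pi.single j 1 = b := sub_single_add_single hb
      by_cases hab : a' = b - Pi.single j 1
      · rw [if_pos hab, if_pos (by rw [hab, hbb])]
        have hfac : ∀ i, (((a' + Pi.single j 1 : ι → ℕ) i).factorial : ℝ) =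
            (if i = j then (b j : ℝ) else 1) * (a' i).factorial := by
          intro i
          split_ifs with h
          · subst h
            have : b i = a' i + 1 := by rw [← hbb, hab]; simp
            rw [this]
            simp [Nat.factorial_succ]
          · simp [h]
        rw [Finset.prod_congr rfl fun i _ => hfac i, Finset.prod_mul_distrib]
        simp
      · rw [if_neg hab, if_neg, mul_zero]
        intro h
        apply hab
        rw [← h]
        ext i
        simp

end GaussianHermite

/-! ### Several samples: factorisation over rows and Cauchy–Schwarz -/

section Samples

open MvPolynomial Matrix

variable {n d : ℕ}

lemma integrable_evalAt_pi (μ : Fin n → Measure (EuclideanSpace ℝ (Fin (d + 1))))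
    [∀ i, IsGaussian (μ i)] (f : SamplePoly n d) : Integrable f.evalAt (Measure.pi μ) := by
  unfold SamplePoly.evalAt
  induction f using MvPolynomial.induction_on' with
  | monomial a c =>
    have h : ∀ z : Samples n d, eval (fun p : Fin n × Fin (d + 1) => z p.1 p.2) (monomial a c) =
        c * ∏ i, eval (z i).ofLp (∏ j, (X j : MvPolynomial (Fin (d + 1)) ℝ) ^ a (i, j)) := by
      intro z
      rw [eval_monomial_fintype, Fintype.prod_prod_type]
      simp
    simp_rw [h]
    exact (Integrable.fintype_prod fun i => integrable_eval_mvPolynomial _).const_mul c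
  | add p q hp hq =>
    simp only [map_add]
    exact hp.add hq

lemma integrable_evalAt_null (f : SamplePoly n d) : Integrable f.evalAt (null d n) :=
  integrable_evalAt_pi _ f

lemma integral_evalAt_planted (θ : ℝ) (k : ℕ) (f : SamplePoly n d) :
    ∫ z, f.evalAt z ∂(planted θ d k n) = ((signPatterns d k).card : ℝ)⁻¹ *
      ∑ s ∈ signPatterns d k, ∫ z, f.evalAt z
        ∂(Measure.pi fun _ : Fin n => multivariateGaussian 0 (spikedCov θ (spike d k s))) := by
  rw [planted, integral_smul_measure, integral_finsetSum_measure fun s _ =>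
    integrable_evalAt_pi _ f]
  simp

lemma integrable_evalAt_planted {θ : ℝ} (hθ : θ ∈ Set.Ioo (0 : ℝ) 1) (k : ℕ)
    (f : SamplePoly n d) : Integrable f.evalAt (planted θ d k n) := by
  obtain ⟨C, hC, h⟩ := planted_le_smul_null hθ d k n
  exact (integrable_evalAt_null f).of_measure_le_smul hC h

lemma evalAt_hermiteMv (a : Fin n × Fin (d + 1) → ℕ) (z : Samples n d) :
    SamplePoly.evalAt (hermiteMv a) z =
      ∏ i, eval (z i).ofLp (hermiteMv fun j => a (i, j)) := by
  rw [SamplePoly.evalAt, eval_hermiteMv, Fintype.prod_prod_type]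
  simp_rw [eval_hermiteMv]

lemma integral_hermiteMv_pi_spiked {θ : ℝ} (hθ : θ ∈ Set.Icc (0 : ℝ) 1) {x : Fin (d + 1) → ℝ}
    (hx : x ⬝ᵥ x = 1) (a : Fin n × Fin (d + 1) → ℕ) :
    ∫ z, SamplePoly.evalAt (hermiteMv a) z
        ∂(Measure.pi fun _ : Fin n => multivariateGaussian 0 (spikedCov θ x)) =
      (∏ i, hermiteCoeff θ (∑ j, a (i, j))) * ∏ p : Fin n × Fin (d + 1), x p.2 ^ a p := by
  simp_rw [evalAt_hermiteMv]
  rw [integral_fintype_prod_eq_prod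
    (fun i (w : EuclideanSpace ℝ (Fin (d + 1))) => eval w.ofLp (hermiteMv fun j => a (i, j))),
    Fintype.prod_prod_type, ← Finset.prod_mul_distrib]
  exact Finset.prod_congr rfl fun i _ => integral_hermiteMv_spiked hθ hx _

lemma integral_hermiteMv_mul_null (a b : Fin n × Fin (d + 1) → ℕ) :
    ∫ z, SamplePoly.evalAt (hermiteMv a) z * SamplePoly.evalAt (hermiteMv b) z ∂(null d n) =
      if a = b then ∏ p, ((a p).factorial : ℝ) else 0 := by
  simp_rw [evalAt_hermiteMv, ← Finset.prod_mul_distrib, ← map_mul]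
  rw [null, integral_fintype_prod_eq_prod (fun i (w : EuclideanSpace ℝ (Fin (d + 1))) =>
    eval w.ofLp (hermiteMv (fun j => a (i, j)) * hermiteMv fun j => b (i, j)))]
  simp_rw [integral_hermiteMv_mul]
  by_cases hab : a = b
  · subst hab
    simp [Fintype.prod_prod_type]
  · rw [if_neg hab]
    obtain ⟨p, hp⟩ := Function.ne_iff.1 hab
    refine Finset.prod_eq_zero (Finset.mem_univ p.1) (if_neg fun h => hp ?_)
    exact congrFun h p.2

/-- The squared norm in `L²` of the null distribution of the centred low-degree likelihood ratio,
as a sum over Hermite coefficients. -/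
def hermiteEnergy (θ : ℝ) (d k n D : ℕ) : ℝ :=
  ∑ a ∈ (multiIndices (Fin n × Fin (d + 1)) D).erase 0,
    (∫ z, SamplePoly.evalAt (hermiteMv a) z ∂(planted θ d k n)) ^ 2 / ∏ p, ((a p).factorial : ℝ)

lemma sq_integral_planted_le {θ : ℝ} (hθ : θ ∈ Set.Ioo (0 : ℝ) 1) (k : ℕ) {D : ℕ}
    {f : SamplePoly n d} (hf : f.totalDegree ≤ D) (h0 : ∫ z, f.evalAt z ∂(null d n) = 0) :
    (∫ z, f.evalAt z ∂(planted θ d k n)) ^ 2 ≤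
      hermiteEnergy θ d k n D * ∫ z, f.evalAt z ^ 2 ∂(null d n) := by
  obtain ⟨c, hc⟩ := exists_eq_sum_hermiteMv hf
  have heval : ∀ z, f.evalAt z = ∑ a ∈ multiIndices (Fin n × Fin (d + 1)) D,
      c a * SamplePoly.evalAt (hermiteMv a) z := fun z => by
    rw [hc]; simp [SamplePoly.evalAt, smul_eval]
  have hnull : ∀ g : SamplePoly n d, ∫ z, f.evalAt z * g.evalAt z ∂(null d n) =
      ∑ a ∈ multiIndices (Fin n × Fin (d + 1)) D,
        c a * ∫ z, SamplePoly.evalAt (hermiteMv a) z * g.evalAt z ∂(null d n) := by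
    intro g
    simp_rw [heval, Finset.sum_mul, ← integral_const_mul, mul_assoc]
    refine integral_finsetSum _ fun a _ => Integrable.const_mul ?_ _
    exact (integrable_evalAt_null (hermiteMv a * g)).congr (ae_of_all _ fun z => by
      simp [SamplePoly.evalAt])
  have hcoeff : ∀ b ∈ multiIndices (Fin n × Fin (d + 1)) D,
      ∫ z, f.evalAt z * SamplePoly.evalAt (hermiteMv b) z ∂(null d n) =
        c b * ∏ p, ((b p).factorial : ℝ) := by
    intro b hb
    rw [hnull]
    simp_rw [integral_hermiteMv_mul_null]
    simp [hb]
  -- Centring removes the constant coefficient, which is why the energy omits the index `0`.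
  have hc0 : c 0 = 0 := by
    have h1 : ∀ z : Samples n d,
        SamplePoly.evalAt (hermiteMv (0 : Fin n × Fin (d + 1) → ℕ)) z = 1 :=
      fun z => by simp [SamplePoly.evalAt, hermiteMv_zero]
    have := hcoeff 0 (mem_multiIndices.2 (by simp))
    simp only [h1, mul_one, h0] at this
    simpa using this.symm
  have hsq : ∫ z, f.evalAt z ^ 2 ∂(null d n) =
      ∑ a ∈ (multiIndices (Fin n × Fin (d + 1)) D).erase 0,
        c a ^ 2 * ∏ p, ((a p).factorial : ℝ) := by
    simp_rw [pow_two (f.evalAt _)]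
    rw [hnull, Finset.sum_erase _ (by simp [hc0])]
    refine Finset.sum_congr rfl fun a ha => ?_
    simp_rw [mul_comm (SamplePoly.evalAt (hermiteMv a) _)]
    rw [hcoeff a ha]
    ring
  have hP : ∫ z, f.evalAt z ∂(planted θ d k n) =
      ∑ a ∈ (multiIndices (Fin n × Fin (d + 1)) D).erase 0,
        c a * ∫ z, SamplePoly.evalAt (hermiteMv a) z ∂(planted θ d k n) := by
    rw [Finset.sum_erase _ (by simp [hc0])]
    simp_rw [heval, ← integral_const_mul]
    exact integral_finsetSum _ fun a _ => (integrable_evalAt_planted hθ k _).const_mul _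
  rw [hP, hsq, hermiteEnergy]
  -- Cauchy–Schwarz with weights `a!`: the square of each summand is exactly the product of the
  -- corresponding terms of the two sums.
  refine Finset.sum_sq_le_sum_mul_sum_of_sq_le_mul _ (fun a _ => by positivity)
    (fun a _ => by positivity) fun a _ => le_of_eq ?_
  have : ∏ p, ((a p).factorial : ℝ) ≠ 0 :=
    Finset.prod_ne_zero_iff.2 fun p _ => by positivity
  field_simp

end Samples

/-! ### Reducing the energy to moments of the spike overlap -/

section Energy

open Matrix

/-- Two steps multiply the square by `θ²(m+1)² ≤ (m+1)(m+2)`. This `m!` cancels the denominator left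
by the multinomial theorem, removing the dependence on `θ`. -/
lemma hermiteCoeff_sq_le {θ : ℝ} (hθ : θ ∈ Set.Icc (0 : ℝ) 1) (m : ℕ) :
    hermiteCoeff θ m ^ 2 ≤ m.factorial := by
  induction m using Nat.twoStepInduction with
  | zero => simp [hermiteCoeff]
  | one => simp [hermiteCoeff]
  | more m ih _ =>
    have hθ2 : θ ^ 2 ≤ 1 := pow_le_one₀ hθ.1 hθ.2
    calc hermiteCoeff θ (m + 2) ^ 2 = θ ^ 2 * (((m : ℝ) + 1) ^ 2 * hermiteCoeff θ m ^ 2) := by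
          rw [hermiteCoeff]; ring
      _ ≤ 1 * (((m : ℝ) + 1) ^ 2 * m.factorial) := by gcongr
      _ ≤ ((m : ℝ) + 2) * ((m : ℝ) + 1) * m.factorial := by
          rw [one_mul]
          gcongr
          nlinarith [(Nat.cast_nonneg m : (0 : ℝ) ≤ m)]
      _ = (m + 2).factorial := by
          rw [Nat.factorial_succ, Nat.factorial_succ]; push_cast; ring

lemma hermiteCoeff_of_odd (θ : ℝ) {m : ℕ} (hm : Odd m) : hermiteCoeff θ m = 0 := by
  obtain ⟨r, rfl⟩ := hm
  induction r with
  | zero => simp [hermiteCoeff]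
  | succ r ih => rw [show 2 * (r + 1) + 1 = (2 * r + 1) + 2 by ring, hermiteCoeff, ih, mul_zero]

lemma sum_piAntidiag_prod_pow_div_factorial {ι : Type*} [Fintype ι] [DecidableEq ι] (u : ι → ℝ)
    (r : ℕ) :
    ∑ a ∈ Finset.piAntidiag Finset.univ r, ∏ j, u j ^ a j / (a j).factorial =
      (∑ j, u j) ^ r / r.factorial := by
  rw [Finset.sum_pow_eq_sum_piAntidiag, Finset.sum_div]
  refine Finset.sum_congr rfl fun a ha => ?_
  have ha' : ∑ j, a j = r := (Finset.mem_piAntidiag.1 ha).1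
  have hspec : (∏ j, ((a j).factorial : ℝ)) * Nat.multinomial Finset.univ a = r.factorial := by
    rw [← ha']
    exact_mod_cast Nat.multinomial_spec Finset.univ a
  have h1 : ∏ j, ((a j).factorial : ℝ) ≠ 0 := Finset.prod_ne_zero_iff.2 fun p _ => by positivity
  rw [Finset.prod_div_distrib, div_eq_div_iff h1 (by positivity), ← hspec]
  ring

/-- The multi-indices whose `i`-th row has order `2 m i`. -/
def evenRowIndices {n : ℕ} (d : ℕ) (m : Fin n → ℕ) : Finset (Fin n × Fin (d + 1) → ℕ) :=
  (Fintype.piFinset fun i => Finset.piAntidiag (Finset.univ : Finset (Fin (d + 1))) (2 * m i)).map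
    (Equiv.curry (Fin n) (Fin (d + 1)) ℕ).symm.toEmbedding

lemma mem_evenRowIndices {n d : ℕ} {m : Fin n → ℕ} {a : Fin n × Fin (d + 1) → ℕ} :
    a ∈ evenRowIndices d m ↔ ∀ i, ∑ j, a (i, j) = 2 * m i := by
  rw [evenRowIndices, Finset.mem_map_equiv]
  simp
  rfl

/-- The sum factorises over rows, and by the multinomial theorem each row gives `c² ⟨x, y⟩^{2m} /
(2m)!`. Evenness keeps the powers nonnegative, so `c² ≤ (2m)!` applies even if `⟨x, y⟩ < 0`. -/
lemma sum_evenRowIndices_le {n d : ℕ} {θ : ℝ} (hθ : θ ∈ Set.Icc (0 : ℝ) 1) (m : Fin n → ℕ)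
    (x y : Fin (d + 1) → ℝ) :
    ∑ a ∈ evenRowIndices d m, (∏ i, hermiteCoeff θ (∑ j, a (i, j))) ^ 2 *
      ((∏ p : Fin n × Fin (d + 1), x p.2 ^ a p) * ∏ p : Fin n × Fin (d + 1), y p.2 ^ a p) /
        ∏ p, ((a p).factorial : ℝ) ≤ (x ⬝ᵥ y) ^ (2 * ∑ i, m i) := by
  have h1 : ∀ a ∈ evenRowIndices d m, (∏ i, hermiteCoeff θ (∑ j, a (i, j))) ^ 2 *
      ((∏ p : Fin n × Fin (d + 1), x p.2 ^ a p) * ∏ p : Fin n × Fin (d + 1), y p.2 ^ a p) /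
        ∏ p, ((a p).factorial : ℝ) = (∏ i, hermiteCoeff θ (2 * m i) ^ 2) *
          ∏ i, ∏ j, (x j * y j) ^ a (i, j) / (a (i, j)).factorial := by
    intro a ha
    rw [Finset.prod_congr rfl fun i _ => by rw [mem_evenRowIndices.1 ha i], ← Finset.prod_pow,
      mul_div_assoc, ← Finset.prod_mul_distrib, ← Finset.prod_div_distrib,
      Fintype.prod_prod_type]
    simp_rw [mul_pow]
  rw [Finset.sum_congr rfl h1, ← Finset.mul_sum, evenRowIndices, Finset.sum_map]
  have h2 := Finset.prod_univ_sum
    (fun i : Fin n => Finset.piAntidiag (Finset.univ : Finset (Fin (d + 1))) (2 * m i))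
    (fun (_ : Fin n) (b : Fin (d + 1) → ℕ) => ∏ j, (x j * y j) ^ b j / ((b j).factorial : ℝ))
  have h3 : ∑ b ∈ Fintype.piFinset fun i : Fin n =>
      Finset.piAntidiag (Finset.univ : Finset (Fin (d + 1))) (2 * m i),
      ∏ i, ∏ j, (x j * y j) ^ ((Equiv.curry (Fin n) (Fin (d + 1)) ℕ).symm.toEmbedding b) (i, j) /
        ((((Equiv.curry (Fin n) (Fin (d + 1)) ℕ).symm.toEmbedding b) (i, j)).factorial : ℝ) =
      ∏ i, (x ⬝ᵥ y) ^ (2 * m i) / ((2 * m i).factorial : ℝ) := by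
    simp_rw [sum_piAntidiag_prod_pow_div_factorial] at h2
    exact h2.symm
  rw [h3, ← Finset.prod_mul_distrib, Finset.mul_sum, ← Finset.prod_pow_eq_pow_sum]
  refine Finset.prod_le_prod (fun i _ => ?_) fun i _ => ?_
  · have : 0 ≤ (x ⬝ᵥ y) ^ (2 * m i) := (even_two_mul _).pow_nonneg _
    positivity
  · have h0 : 0 ≤ (x ⬝ᵥ y) ^ (2 * m i) := (even_two_mul _).pow_nonneg _
    rw [mul_div_assoc', div_le_iff₀ (by positivity), mul_comm]
    exact mul_le_mul_of_nonneg_left (hermiteCoeff_sq_le hθ _) h0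

/-- The square of an average over spikes is a double average over pairs. Rows of odd order
contribute nothing, so terms are grouped by half row orders `m`, and the bound for each group
depends only on `∑ m_i`. -/
lemma hermiteEnergy_le {θ : ℝ} (hθ : θ ∈ Set.Ioo (0 : ℝ) 1) (d k n D : ℕ) :
    hermiteEnergy θ d k n D ≤ ∑ M ∈ Finset.Icc 1 (D / 2),
      ((Finset.piAntidiag (Finset.univ : Finset (Fin n)) M).card : ℝ) *
        (((signPatterns d k).card : ℝ)⁻¹ ^ 2 * ∑ s ∈ signPatterns d k, ∑ s' ∈ signPatterns d k,
          (spike d k s ⬝ᵥ spike d k s') ^ (2 * M)) := by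
  have hθ' : θ ∈ Set.Icc (0 : ℝ) 1 := Set.Ioo_subset_Icc_self hθ
  set N : ℝ := ((signPatterns d k).card : ℝ)
  set T : (Fin n × Fin (d + 1) → ℕ) → ℝ := fun a =>
    (∫ z, SamplePoly.evalAt (hermiteMv a) z ∂(planted θ d k n)) ^ 2 / ∏ p, ((a p).factorial : ℝ)
    with hT
  have hT0 : ∀ a, 0 ≤ T a := fun a => by positivity
  have hint : ∀ a : Fin n × Fin (d + 1) → ℕ,
      ∫ z, SamplePoly.evalAt (hermiteMv a) z ∂(planted θ d k n) =
        N⁻¹ * ((∏ i, hermiteCoeff θ (∑ j, a (i, j))) *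
          ∑ s ∈ signPatterns d k, ∏ p : Fin n × Fin (d + 1), spike d k s p.2 ^ a p) := by
    intro a
    rw [integral_evalAt_planted, Finset.mul_sum (signPatterns d k) _ (∏ i, _)]
    congr 1
    exact Finset.sum_congr rfl fun s hs =>
      integral_hermiteMv_pi_spiked hθ' (spike_dotProduct_self hs) a
  have hTodd : ∀ a, T a ≠ 0 → ∀ i, Even (∑ j, a (i, j)) := by
    intro a ha i
    by_contra hodd
    apply ha
    have : ∏ i, hermiteCoeff θ (∑ j, a (i, j)) = 0 :=
      Finset.prod_eq_zero (Finset.mem_univ i)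
        (hermiteCoeff_of_odd θ (Nat.not_even_iff_odd.1 hodd))
    simp [hT, hint, this]
  have hrow : ∀ m : Fin n → ℕ, ∑ a ∈ evenRowIndices d m, T a ≤
      N⁻¹ ^ 2 * ∑ s ∈ signPatterns d k, ∑ s' ∈ signPatterns d k,
        (spike d k s ⬝ᵥ spike d k s') ^ (2 * ∑ i, m i) := by
    intro m
    have e : ∀ a, T a = ∑ s ∈ signPatterns d k, ∑ s' ∈ signPatterns d k,
        N⁻¹ ^ 2 * ((∏ i, hermiteCoeff θ (∑ j, a (i, j))) ^ 2 *
          ((∏ p : Fin n × Fin (d + 1), spike d k s p.2 ^ a p) *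
            ∏ p : Fin n × Fin (d + 1), spike d k s' p.2 ^ a p) /
          ∏ p, ((a p).factorial : ℝ)) := by
      intro a
      simp only [← Finset.mul_sum, ← Finset.sum_div, ← Finset.sum_mul]
      simp only [hT, hint]
      ring
    simp_rw [e]
    rw [Finset.sum_comm, Finset.mul_sum]
    refine Finset.sum_le_sum fun s _ => ?_
    rw [Finset.sum_comm, Finset.mul_sum]
    refine Finset.sum_le_sum fun s' _ => ?_
    rw [← Finset.mul_sum]
    exact mul_le_mul_of_nonneg_left (sum_evenRowIndices_le hθ' m _ _) (by positivity)
  -- Discarding vanishing terms makes every row order even, so halving loses nothing.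
  set S := ((multiIndices (Fin n × Fin (d + 1)) D).erase 0).filter fun a => T a ≠ 0
  have hSrow : ∀ a ∈ S, ∀ i, ∑ j, a (i, j) = 2 * ((∑ j, a (i, j)) / 2) := fun a ha i =>
    (Nat.two_mul_div_two_of_even (hTodd a (Finset.mem_filter.1 ha).2 i)).symm
  have hmaps : ∀ a ∈ S, (fun i => (∑ j, a (i, j)) / 2) ∈
      (Finset.Icc 1 (D / 2)).biUnion fun M =>
        Finset.piAntidiag (Finset.univ : Finset (Fin n)) M := by
    intro a ha
    have hmem := (Finset.mem_filter.1 ha).1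
    have h0 : a ≠ 0 := Finset.ne_of_mem_erase hmem
    have hD : ∑ p, a p ≤ D := mem_multiIndices.1 (Finset.mem_of_mem_erase hmem)
    have hsum : ∑ p, a p = 2 * ∑ i, (∑ j, a (i, j)) / 2 := by
      rw [Fintype.sum_prod_type, Finset.mul_sum]
      exact Finset.sum_congr rfl fun i _ => hSrow a ha i
    have hpos : ∑ p, a p ≠ 0 := by
      intro h
      exact h0 (funext fun p => Finset.sum_eq_zero_iff.1 h p (Finset.mem_univ p))
    simp only [Finset.mem_biUnion, Finset.mem_Icc, Finset.mem_piAntidiag, Finset.mem_univ,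
      implies_true, and_true, exists_eq_right']
    omega
  calc hermiteEnergy θ d k n D = ∑ a ∈ S, T a := (Finset.sum_filter_ne_zero _).symm
    _ = ∑ m ∈ (Finset.Icc 1 (D / 2)).biUnion fun M =>
          Finset.piAntidiag (Finset.univ : Finset (Fin n)) M,
          ∑ a ∈ S with (fun i => (∑ j, a (i, j)) / 2) = m, T a :=
        (Finset.sum_fiberwise_of_maps_to hmaps _).symm
    _ ≤ ∑ m ∈ (Finset.Icc 1 (D / 2)).biUnion fun M =>
          Finset.piAntidiag (Finset.univ : Finset (Fin n)) M,
          ∑ a ∈ evenRowIndices d m, T a := by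
        refine Finset.sum_le_sum fun m _ => Finset.sum_le_sum_of_subset_of_nonneg ?_
          fun a _ _ => hT0 a
        intro a ha
        obtain ⟨ha1, rfl⟩ := Finset.mem_filter.1 ha
        exact mem_evenRowIndices.2 (hSrow a ha1)
    _ = ∑ M ∈ Finset.Icc 1 (D / 2), ∑ m ∈ Finset.piAntidiag (Finset.univ : Finset (Fin n)) M,
          ∑ a ∈ evenRowIndices d m, T a := by
        refine Finset.sum_biUnion fun M _ M' _ hMM' => ?_
        refine Finset.disjoint_left.2 fun m hm hm' => hMM' ?_
        rw [← (Finset.mem_piAntidiag.1 hm).1, ← (Finset.mem_piAntidiag.1 hm').1]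
    _ ≤ _ := by
        refine Finset.sum_le_sum fun M _ => ?_
        rw [← nsmul_eq_mul]
        refine Finset.sum_le_card_nsmul _ _ _ fun m hm => ?_
        have hM : ∑ i, m i = M := (Finset.mem_piAntidiag.1 hm).1
        rw [← hM]
        exact hrow m

end Energy

/-! ### Moments of the overlap of two random sign patterns -/

section Overlap

open Matrix

/-- The ratio of the binomials is `∏ (k - i)/(d - i)` over `i < j`, and each factor is at most
`k/d`. -/
lemma choose_sub_mul_pow_le {d k : ℕ} (hkd : k ≤ d) (j : ℕ) (hj : j ≤ k) :
    (d - j).choose (k - j) * d ^ j ≤ d.choose k * k ^ j := by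
  induction j with
  | zero => simp
  | succ j ih =>
    have hpos : 0 < d - j := by omega
    refine Nat.le_of_mul_le_mul_right ?_ hpos
    have h1 : (d - (j + 1)).choose (k - (j + 1)) * (d - j) = (d - j).choose (k - j) * (k - j) := by
      have h := Nat.add_one_mul_choose_eq (d - (j + 1)) (k - (j + 1))
      rw [show d - (j + 1) + 1 = d - j by omega, show k - (j + 1) + 1 = k - j by omega] at h
      rw [← h, mul_comm]
    have h2 : (k - j) * d ≤ k * (d - j) := by
      rw [Nat.sub_mul, Nat.mul_sub]
      have : j * k ≤ j * d := Nat.mul_le_mul_left _ hkd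
      have e : k * j = j * k := mul_comm _ _
      omega
    calc (d - (j + 1)).choose (k - (j + 1)) * d ^ (j + 1) * (d - j)
        = ((d - (j + 1)).choose (k - (j + 1)) * (d - j)) * d ^ (j + 1) := by ring
      _ = ((d - j).choose (k - j) * d ^ j) * ((k - j) * d) := by rw [h1]; ring
      _ ≤ (d.choose k * k ^ j) * (k * (d - j)) := Nat.mul_le_mul (ih (by omega)) h2
      _ = d.choose k * k ^ (j + 1) * (d - j) := by ring

lemma card_filter_subset_le {d k : ℕ} (hkd : k ≤ d) (J : Finset (Fin d)) :
    (((Finset.univ.powersetCard k).filter (J ⊆ ·)).card : ℝ) ≤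
      d.choose k * ((k : ℝ) / d) ^ J.card := by
  by_cases hJ : J.card ≤ k
  · rw [Finset.card_filter_powersetCard_subset _ _ _ (Finset.subset_univ _) hJ, Finset.card_univ,
      Fintype.card_fin]
    rcases Nat.eq_zero_or_pos d with rfl | hd
    · have : J.card = 0 := by omega
      simp [this]
    · rw [div_pow, mul_div_assoc', le_div_iff₀ (by positivity)]
      exact_mod_cast choose_sub_mul_pow_le hkd _ hJ
  · have : (Finset.univ.powersetCard k).filter (J ⊆ ·) = ∅ := by
      refine Finset.filter_eq_empty_iff.2 fun U hU hJU => hJ ?_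
      rw [← (Finset.mem_powersetCard.1 hU).2]
      exact Finset.card_le_card hJU
    rw [this, Finset.card_empty, Nat.cast_zero]
    positivity

/-- Expanding `(1 + c)^|U ∩ V|` over subsets `J` of `U ∩ V` reduces this to `P(J ⊆ U) ≤ (k/d)^|J|`:
the hypergeometric generating function is dominated by the binomial one. -/
lemma sum_powersetCard_pow_inter_le {d k : ℕ} (hkd : k ≤ d) (V : Finset (Fin d)) {c : ℝ}
    (hc : 0 ≤ c) :
    ∑ U ∈ Finset.univ.powersetCard k, (1 + c) ^ (U ∩ V).card ≤
      d.choose k * (1 + c * (k / d)) ^ V.card := by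
  have h1 : ∀ U : Finset (Fin d), (1 + c) ^ (U ∩ V).card =
      ∑ J ∈ V.powerset, if J ⊆ U then c ^ J.card else 0 := by
    intro U
    rw [← Finset.prod_const, Finset.prod_one_add, ← Finset.sum_filter]
    have : V.powerset.filter (· ⊆ U) = (U ∩ V).powerset := by
      ext J
      rw [Finset.mem_filter, Finset.mem_powerset, Finset.mem_powerset, Finset.subset_inter_iff,
        and_comm]
    rw [this]
    simp
  have h2 : (1 + c * ((k : ℝ) / d)) ^ V.card =
      ∑ J ∈ V.powerset, (c * ((k : ℝ) / d)) ^ J.card := by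
    rw [← Finset.prod_const, Finset.prod_one_add]
    simp
  simp_rw [h1]
  rw [Finset.sum_comm, h2, Finset.mul_sum]
  refine Finset.sum_le_sum fun J _ => ?_
  rw [← Finset.sum_filter, Finset.sum_const, nsmul_eq_mul, mul_pow]
  calc _ ≤ (d.choose k * ((k : ℝ) / d) ^ J.card) * c ^ J.card :=
        mul_le_mul_of_nonneg_right (card_filter_subset_le hkd J) (by positivity)
    _ = _ := by ring

lemma sum_signPatterns_prod {d k : ℕ} (g : Fin d → SignType → ℝ) (hg : ∀ i, g i 0 = 1) :
    ∑ s ∈ signPatterns d k, ∏ i, g i (s i) =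
      ∑ U ∈ Finset.univ.powersetCard k, ∏ i ∈ U, (g i 1 + g i (-1)) := by
  have hmaps : ∀ s ∈ signPatterns d k, (Finset.univ.filter fun i => s i ≠ 0) ∈
      (Finset.univ : Finset (Fin d)).powersetCard k := by
    intro s hs
    simpa [signPatterns, Finset.mem_powersetCard] using hs
  rw [← Finset.sum_fiberwise_of_maps_to hmaps]
  refine Finset.sum_congr rfl fun U hU => ?_
  have hUk : U.card = k := (Finset.mem_powersetCard.1 hU).2
  have hfib : (signPatterns d k).filter (fun s => (Finset.univ.filter fun i => s i ≠ 0) = U) =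
      Fintype.piFinset fun i => if i ∈ U then ({1, -1} : Finset SignType) else {0} := by
    ext s
    simp only [Finset.mem_filter, signPatterns, Finset.mem_univ, true_and, Fintype.mem_piFinset]
    constructor
    · rintro ⟨-, rfl⟩ i
      rcases h : s i <;> simp [h]
    · intro h
      have hs : (Finset.univ.filter fun i => s i ≠ 0) = U := by
        ext i
        have hi := h i
        by_cases hiU : i ∈ U
        · rw [if_pos hiU] at hi
          rcases h : s i <;> simp_all
        · rw [if_neg hiU] at hi
          simp_all
      exact ⟨by rw [hs, hUk], hs⟩
  rw [hfib, ← Finset.prod_univ_sum, ← Finset.prod_subset (Finset.subset_univ U)]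
  · exact Finset.prod_congr rfl fun i hi => by simp [hi]
  · intro i _ hi
    simp [hi, hg]

lemma card_signPatterns (d k : ℕ) :
    ((signPatterns d k).card : ℝ) = d.choose k * 2 ^ k := by
  have h := sum_signPatterns_prod (d := d) (k := k) (fun _ _ => 1) fun _ => rfl
  simp only [Finset.prod_const_one, Finset.sum_const, nsmul_eq_mul, mul_one,
    Finset.prod_const] at h
  rw [h, Finset.sum_congr rfl fun U hU => by rw [(Finset.mem_powersetCard.1 hU).2],
    Finset.sum_const, Finset.card_powersetCard, Finset.card_univ, Fintype.card_fin, nsmul_eq_mul]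
  norm_num

/-- The inner product of two sign patterns. -/
def overlap {d : ℕ} (s s' : Fin d → SignType) : ℝ :=
  ∑ i, ((s i : SignType) : ℝ) * ((s' i : SignType) : ℝ)

/-- Given the support `U` of `s`, the signs are independent and each index in `U ∩ V` contributes
`cosh t`. Averaging over `U` is the previous estimate with `c = cosh t - 1`. -/
lemma sum_exp_overlap_le {d k : ℕ} (hkd : k ≤ d) {y : Fin d → SignType}
    (hy : y ∈ signPatterns d k) (t : ℝ) :
    ∑ s ∈ signPatterns d k, Real.exp (t * overlap s y) ≤
      (signPatterns d k).card * Real.exp ((k : ℝ) ^ 2 / d * (Real.cosh t - 1)) := by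
  set V : Finset (Fin d) := Finset.univ.filter fun i => y i ≠ 0 with hV
  have hVk : V.card = k := by simpa [signPatterns] using hy
  have hc : 0 ≤ Real.cosh t - 1 := by linarith [Real.one_le_cosh t]
  have h1 : ∀ s : Fin d → SignType, Real.exp (t * overlap s y) =
      ∏ i, Real.exp (t * (((s i : SignType) : ℝ) * ((y i : SignType) : ℝ))) := by
    intro s
    rw [← Real.exp_sum, overlap, Finset.mul_sum]
  have h2 : ∀ i, Real.exp (t * (((1 : SignType) : ℝ) * ((y i : SignType) : ℝ))) +
      Real.exp (t * (((-1 : SignType) : ℝ) * ((y i : SignType) : ℝ))) =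
      2 * if i ∈ V then Real.cosh t else 1 := by
    intro i
    rcases h : y i <;> simp [hV, h, Real.cosh_eq] <;> ring
  simp_rw [h1]
  rw [sum_signPatterns_prod
    (fun i σ => Real.exp (t * ((σ : ℝ) * ((y i : SignType) : ℝ)))) (by simp)]
  have h3 : ∀ U ∈ (Finset.univ : Finset (Fin d)).powersetCard k,
      ∏ i ∈ U, (Real.exp (t * (((1 : SignType) : ℝ) * ((y i : SignType) : ℝ))) +
        Real.exp (t * (((-1 : SignType) : ℝ) * ((y i : SignType) : ℝ)))) =
      2 ^ k * (1 + (Real.cosh t - 1)) ^ (U ∩ V).card := by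
    intro U hU
    rw [Finset.prod_congr rfl fun i _ => h2 i, Finset.prod_mul_distrib, Finset.prod_const,
      (Finset.mem_powersetCard.1 hU).2, ← Finset.prod_filter, Finset.prod_const,
      Finset.filter_mem_eq_inter]
    ring
  rw [Finset.sum_congr rfl h3, ← Finset.mul_sum, card_signPatterns]
  have h4 := sum_powersetCard_pow_inter_le hkd V hc
  have h5 : (1 + (Real.cosh t - 1) * ((k : ℝ) / d)) ^ V.card ≤
      Real.exp ((k : ℝ) ^ 2 / d * (Real.cosh t - 1)) := by
    rw [hVk]
    calc _ ≤ Real.exp ((Real.cosh t - 1) * ((k : ℝ) / d)) ^ k := by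
          refine pow_le_pow_left₀ (by positivity) ?_ _
          rw [add_comm]
          exact Real.add_one_le_exp _
      _ = _ := by
          rw [← Real.exp_nat_mul]
          congr 1
          ring
  calc _ ≤ 2 ^ k * (d.choose k * (1 + (Real.cosh t - 1) * ((k : ℝ) / d)) ^ V.card) := by gcongr
    _ ≤ 2 ^ k * (d.choose k * Real.exp ((k : ℝ) ^ 2 / d * (Real.cosh t - 1))) := by gcongr
    _ = _ := by ring

lemma pow_two_mul_le_factorial_mul_exp (x : ℝ) (M : ℕ) :
    x ^ (2 * M) ≤ (2 * M).factorial * (Real.exp x + Real.exp (-x)) := by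
  have h := Real.pow_div_factorial_le_exp |x| (abs_nonneg x) (2 * M)
  rw [div_le_iff₀ (by positivity), (even_two_mul M).pow_abs] at h
  refine h.trans ?_
  rw [mul_comm]
  gcongr
  rcases abs_cases x with ⟨h, _⟩ | ⟨h, _⟩ <;> rw [h] <;> linarith [Real.exp_pos x, Real.exp_pos (-x)]

lemma cosh_sub_one_le_sq {t : ℝ} (ht : t ^ 2 ≤ 1) : Real.cosh t - 1 ≤ t ^ 2 := by
  have h1 := Real.cosh_le_exp_half_sq t
  have h2 := Real.abs_exp_sub_one_le (x := t ^ 2 / 2) (by rw [abs_of_nonneg] <;> nlinarith)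
  rw [abs_of_nonneg (by positivity : 0 ≤ t ^ 2 / 2)] at h2
  linarith [le_abs_self (Real.exp (t ^ 2 / 2) - 1)]

lemma sum_one_add_overlap_pow_le {d k : ℕ} (hkd : k ≤ d) {y : Fin d → SignType}
    (hy : y ∈ signPatterns d k) {M : ℕ} (hM : 1 ≤ M) :
    ∑ s ∈ signPatterns d k, (1 + overlap s y) ^ (2 * M) ≤
      (signPatterns d k).card * ((2 * M).factorial * (2 * Real.exp 1 * Real.exp M) *
        ((M + (k : ℝ) ^ 2 / d) / M) ^ M) := by
  set lam : ℝ := (k : ℝ) ^ 2 / d with hlam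
  have hl0 : 0 ≤ lam := by positivity
  have hM0 : (0 : ℝ) < M := by exact_mod_cast hM
  -- Chosen so that `t ≤ 1` and `lam * t² ≤ M`: the exponential moment costs at most `e^M`, while
  -- dividing by `t^{2M}` yields the factor `((M + lam)/M)^M`.
  set t : ℝ := √(M / (M + lam)) with ht
  have ht2 : t ^ 2 = M / (M + lam) := Real.sq_sqrt (by positivity)
  have ht0 : 0 ≤ t := Real.sqrt_nonneg _
  have ht2le : t ^ 2 ≤ 1 := by
    rw [ht2]
    exact div_le_one_of_le₀ (by linarith) (by positivity)
  have ht1 : t ≤ 1 := by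
    by_contra! h
    nlinarith
  set N : ℝ := ((signPatterns d k).card : ℝ)
  have hN0 : 0 ≤ N := Nat.cast_nonneg _
  -- Needed for `u = t` and `u = -t`; the factor `e` pays for the deterministic `1` contributed by
  -- the first coordinate of the spikes.
  have hexp : ∀ u : ℝ, u ^ 2 = t ^ 2 → u ≤ 1 →
      ∑ s ∈ signPatterns d k, Real.exp (u * (1 + overlap s y)) ≤
        N * (Real.exp 1 * Real.exp M) := by
    intro u hu hu1
    have h1 : ∀ s, Real.exp (u * (1 + overlap s y)) =
        Real.exp u * Real.exp (u * overlap s y) := fun s => by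
      rw [← Real.exp_add]; congr 1; ring
    simp_rw [h1]
    rw [← Finset.mul_sum]
    calc _ ≤ Real.exp 1 * (N * Real.exp M) := by
          refine mul_le_mul (Real.exp_le_exp.2 hu1) ((sum_exp_overlap_le hkd hy u).trans ?_)
            (Finset.sum_nonneg fun _ _ => (Real.exp_pos _).le) (Real.exp_pos _).le
          refine mul_le_mul_of_nonneg_left (Real.exp_le_exp.2 ?_) hN0
          calc lam * (Real.cosh u - 1) ≤ lam * u ^ 2 :=
                mul_le_mul_of_nonneg_left (cosh_sub_one_le_sq (by rw [hu]; exact ht2le)) hl0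
            _ = M * (lam / (M + lam)) := by rw [hu, ht2]; ring
            _ ≤ M * 1 := by
                gcongr
                exact div_le_one_of_le₀ (by linarith) (by positivity)
            _ = M := mul_one _
      _ = _ := by ring
  have hmain : (t ^ 2) ^ M * ∑ s ∈ signPatterns d k, (1 + overlap s y) ^ (2 * M) ≤
      (2 * M).factorial * (N * (2 * Real.exp 1 * Real.exp M)) := by
    calc _ = ∑ s ∈ signPatterns d k, (t * (1 + overlap s y)) ^ (2 * M) := by
          rw [Finset.mul_sum]
          exact Finset.sum_congr rfl fun s _ => by rw [mul_pow, pow_mul t]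
      _ ≤ ∑ s ∈ signPatterns d k, ((2 * M).factorial : ℝ) *
          (Real.exp (t * (1 + overlap s y)) + Real.exp (-t * (1 + overlap s y))) := by
          refine Finset.sum_le_sum fun s _ => ?_
          rw [neg_mul]
          exact pow_two_mul_le_factorial_mul_exp _ _
      _ ≤ _ := by
          rw [← Finset.mul_sum, Finset.sum_add_distrib]
          gcongr
          linarith [hexp t rfl ht1, hexp (-t) (by ring) (by linarith)]
  have hpos : 0 < (t ^ 2) ^ M := by rw [ht2]; positivity
  rw [← le_div_iff₀' hpos] at hmain
  refine hmain.trans (le_of_eq ?_)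
  rw [ht2, div_eq_mul_inv, ← inv_pow, inv_div]
  ring

lemma card_piAntidiag_le (n M : ℕ) :
    ((Finset.piAntidiag (Finset.univ : Finset (Fin n)) M).card : ℝ) ≤
      ((n : ℝ) + M) ^ M / M.factorial := by
  have h : (Finset.piAntidiag (Finset.univ : Finset (Fin n)) M).card = (n + M - 1).choose M := by
    rw [← Finset.map_sym_eq_piAntidiag, Finset.card_map, Finset.sym_univ, Finset.card_univ,
      Sym.card_sym_eq_choose, Fintype.card_fin]
  rw [h]
  refine (Nat.choose_le_pow_div M _).trans ?_
  gcongr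
  calc ((n + M - 1 : ℕ) : ℝ) ≤ ((n + M : ℕ) : ℝ) := by exact_mod_cast Nat.sub_le _ _
    _ = n + M := by push_cast; ring

/-- The factor `M!` is kept apart to cancel the `1/M!` in the count of `m` with `∑ m_i = M`. -/
lemma factorial_two_mul_le (M : ℕ) :
    ((2 * M).factorial : ℝ) ≤ M.factorial * (2 * M) ^ M := by
  have h : (2 * M).factorial ≤ M.factorial * (2 * M) ^ M := by
    rw [two_mul, ← Nat.factorial_mul_ascFactorial]
    exact Nat.mul_le_mul_left _ (Nat.ascFactorial_le_pow_add M M)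
  exact_mod_cast h

lemma energy_term_le {d k : ℕ} (hkd : k ≤ d) (n : ℕ) {M : ℕ} (hM : 1 ≤ M) :
    ((Finset.piAntidiag (Finset.univ : Finset (Fin n)) M).card : ℝ) *
        (((signPatterns d k).card : ℝ)⁻¹ ^ 2 * ∑ s ∈ signPatterns d k, ∑ s' ∈ signPatterns d k,
          (spike d k s ⬝ᵥ spike d k s') ^ (2 * M)) ≤
      (4 * Real.exp 1 ^ 2 * ((n + M) * (M + (k : ℝ) ^ 2 / d) / ((k : ℝ) + 1) ^ 2)) ^ M := by
  set N : ℝ := ((signPatterns d k).card : ℝ) with hN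
  have hN0 : 0 < N := by
    simpa [hN, Finset.card_pos] using signPatterns_nonempty hkd
  set lam : ℝ := (k : ℝ) ^ 2 / d with hlam
  have hl0 : 0 ≤ lam := by positivity
  have hM0 : (0 : ℝ) < M := by exact_mod_cast hM
  set R : ℝ := (2 * M).factorial * (2 * Real.exp 1 * Real.exp M) * ((M + lam) / M) ^ M with hR
  have hR0 : 0 ≤ R := by positivity
  have h1 : ∑ s ∈ signPatterns d k, ∑ s' ∈ signPatterns d k,
      (spike d k s ⬝ᵥ spike d k s') ^ (2 * M) ≤ N ^ 2 * R / (((k : ℝ) + 1) ^ 2) ^ M := by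
    have e : ∀ s s' : Fin d → SignType, (spike d k s ⬝ᵥ spike d k s') ^ (2 * M) =
        (1 + overlap s s') ^ (2 * M) / (((k : ℝ) + 1) ^ 2) ^ M := fun s s' => by
      rw [spike_dotProduct_spike, div_pow, pow_mul ((k : ℝ) + 1)]
      rfl
    simp_rw [e, ← Finset.sum_div]
    gcongr
    rw [Finset.sum_comm]
    calc _ ≤ ∑ s' ∈ signPatterns d k, N * R :=
          Finset.sum_le_sum fun s' hs' => sum_one_add_overlap_pow_le hkd hs' hM
      _ = N ^ 2 * R := by rw [Finset.sum_const, nsmul_eq_mul]; ring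
  have h2 : N⁻¹ ^ 2 * ∑ s ∈ signPatterns d k, ∑ s' ∈ signPatterns d k,
      (spike d k s ⬝ᵥ spike d k s') ^ (2 * M) ≤ R / (((k : ℝ) + 1) ^ 2) ^ M := by
    calc _ ≤ N⁻¹ ^ 2 * (N ^ 2 * R / (((k : ℝ) + 1) ^ 2) ^ M) := by gcongr
      _ = _ := by field_simp
  -- Since `M ≥ 1`, the constant prefactor is absorbed into the `M`-th power; this is the source of
  -- `4e²`.
  have he : 2 * Real.exp 1 ≤ (2 * Real.exp 1) ^ M :=
    le_self_pow₀ (by linarith [Real.add_one_le_exp (1 : ℝ)]) (by omega)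
  have heM : Real.exp M = Real.exp 1 ^ M := by rw [← Real.exp_nat_mul, mul_one]
  have hR' : R ≤ M.factorial * (4 * Real.exp 1 ^ 2 * (M + lam)) ^ M := by
    calc R ≤ (M.factorial * (2 * M) ^ M) * ((2 * Real.exp 1) ^ M * Real.exp 1 ^ M) *
          ((M + lam) / M) ^ M := by
          rw [hR, ← heM]
          gcongr
          exact factorial_two_mul_le M
      _ = M.factorial * (2 * M * (2 * Real.exp 1) * Real.exp 1 * ((M + lam) / M)) ^ M := by
          simp only [mul_pow]; ring
      _ = _ := by
          congr 2
          field_simp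
          ring
  calc _ ≤ (((n : ℝ) + M) ^ M / M.factorial) *
        (M.factorial * (4 * Real.exp 1 ^ 2 * (M + lam)) ^ M / (((k : ℝ) + 1) ^ 2) ^ M) := by
        refine mul_le_mul (card_piAntidiag_le n M) (h2.trans (by gcongr)) ?_ (by positivity)
        exact mul_nonneg (by positivity) (Finset.sum_nonneg fun s _ => Finset.sum_nonneg fun s' _ =>
          (even_two_mul M).pow_nonneg _)
    _ = _ := by
        have : (M.factorial : ℝ) ≠ 0 := by positivity
        rw [← mul_div_assoc, div_mul_eq_mul_div, ← mul_assoc, mul_comm (_ ^ M) (M.factorial : ℝ),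
          mul_assoc, mul_div_cancel_left₀ _ this, ← mul_pow, ← div_pow]
        congr 1
        ring

lemma sum_Icc_pow_le {r : ℝ} (h0 : 0 ≤ r) (h1 : r ≤ 1 / 2) (m : ℕ) :
    ∑ M ∈ Finset.Icc 1 m, r ^ M ≤ 1 := by
  have h : ∀ m : ℕ, ∑ M ∈ Finset.Icc 1 m, (1 / 2 : ℝ) ^ M = 1 - (1 / 2) ^ m := by
    intro m
    induction m with
    | zero => simp
    | succ m ih => rw [Finset.sum_Icc_succ_top (by omega), ih]; ring
  calc _ ≤ ∑ M ∈ Finset.Icc 1 m, (1 / 2 : ℝ) ^ M := by gcongr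
    _ ≤ 1 := by rw [h]; linarith [pow_pos (one_half_pos (α := ℝ)) m]

lemma hermiteEnergy_le_one {θ : ℝ} (hθ : θ ∈ Set.Ioo (0 : ℝ) 1) {d k : ℕ} (hkd : k ≤ d) (n D : ℕ)
    (h : 4 * Real.exp 1 ^ 2 * ((n + D) * (D + (k : ℝ) ^ 2 / d) / ((k : ℝ) + 1) ^ 2) ≤ 1 / 2) :
    hermiteEnergy θ d k n D ≤ 1 := by
  refine (hermiteEnergy_le hθ d k n D).trans ?_
  refine le_trans (Finset.sum_le_sum fun M hM => ?_) (sum_Icc_pow_le (by positivity) h (D / 2))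
  have hM1 := (Finset.mem_Icc.1 hM).1
  have hMD : (M : ℝ) ≤ D := by
    exact_mod_cast (Finset.mem_Icc.1 hM).2.trans (Nat.div_le_self _ _)
  refine (energy_term_le hkd n hM1).trans ?_
  gcongr

end Overlap

/-! ### Existence and norm of the low-degree projection -/

section Projection

open MvPolynomial

variable {n d : ℕ}

lemma integrable_evalAt_mul_null (f g : SamplePoly n d) :
    Integrable (fun z => f.evalAt z * g.evalAt z) (null d n) :=
  (integrable_evalAt_null (f * g)).congr (ae_of_all _ fun z => by simp [SamplePoly.evalAt])

lemma memLp_evalAt_null (f : SamplePoly n d) : MemLp f.evalAt 2 (null d n) := by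
  rw [memLp_two_iff_integrable_sq (integrable_evalAt_null f).aestronglyMeasurable]
  simpa only [pow_two] using integrable_evalAt_mul_null f f

/-- The class in `L²` of the null distribution of a polynomial. -/
def toLpNull (n d : ℕ) : SamplePoly n d →ₗ[ℝ] Lp ℝ 2 (null d n) where
  toFun f := (memLp_evalAt_null f).toLp
  map_add' f g := by
    rw [← MemLp.toLp_add]
    exact MemLp.toLp_congr _ _ (ae_of_all _ fun z => by simp [SamplePoly.evalAt])
  map_smul' c f := by
    rw [RingHom.id_apply, ← MemLp.toLp_const_smul]
    exact MemLp.toLp_congr _ _ (ae_of_all _ fun z => by simp [SamplePoly.evalAt, smul_eval])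

/-- Polynomials of bounded degree have a finite-dimensional image in `L²`, so the orthogonal
projection onto it exists and is represented by a polynomial. -/
lemma exists_lowDegree_projection {L : Samples n d → ℝ} (hL : MemLp L 2 (null d n)) (D : ℕ) :
    ∃ g : SamplePoly n d, g.totalDegree ≤ D ∧ ∀ h : SamplePoly n d, h.totalDegree ≤ D →
      ∫ z, (L z - g.evalAt z) * h.evalAt z ∂(null d n) = 0 := by
  set K := (restrictTotalDegree (Fin n × Fin (d + 1)) ℝ D).map (toLpNull n d)
  obtain ⟨g, hg, hgp⟩ := K.starProjection_apply_mem hL.toLp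
  refine ⟨g, (mem_restrictTotalDegree _ _ _).1 hg, fun h hh => ?_⟩
  have hmem : toLpNull n d h ∈ K := ⟨h, (mem_restrictTotalDegree _ _ _).2 hh, rfl⟩
  have h0 := K.starProjection_inner_eq_zero hL.toLp _ hmem
  rw [← hgp, L2.inner_def] at h0
  rw [← h0]
  refine integral_congr_ae ?_
  filter_upwards [hL.coeFn_toLp, (memLp_evalAt_null g).coeFn_toLp,
    (memLp_evalAt_null h).coeFn_toLp, Lp.coeFn_sub hL.toLp (toLpNull n d g)] with z h1 h2 h3 h4
  change _ = inner ℝ ((hL.toLp - toLpNull n d g : Lp ℝ 2 (null d n)) z)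
    ((memLp_evalAt_null h).toLp h.evalAt z)
  rw [h4, Pi.sub_apply, h1, h3]
  change _ = inner ℝ (L z - (memLp_evalAt_null g).toLp g.evalAt z) _
  rw [h2]
  simp [mul_comm]

lemma integral_sq_projection_le {θ : ℝ} (hθ : θ ∈ Set.Ioo (0 : ℝ) 1) {k : ℕ} (hkd : k ≤ d)
    {D : ℕ} (hV : hermiteEnergy θ d k n D ≤ 1) {g : SamplePoly n d} (hg : g.totalDegree ≤ D)
    (horth : ∫ z, (likelihoodRatio (planted θ d k n) (null d n) z - g.evalAt z) * g.evalAt z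
      ∂(null d n) = 0) :
    ∫ z, g.evalAt z ^ 2 ∂(null d n) ≤ 2 := by
  have := isProbabilityMeasure_planted θ hkd n
  set G := ∫ z, g.evalAt z ^ 2 ∂(null d n) with hG
  set c := ∫ z, g.evalAt z ∂(null d n) with hc
  -- Testing orthogonality against `g` itself gives `E_P g = E_Q[L g] = E_Q g²`.
  have hPG : ∫ z, g.evalAt z ∂(planted θ d k n) = G := by
    have h1 : Integrable (fun z => likelihoodRatio (planted θ d k n) (null d n) z * g.evalAt z)
        (null d n) := (memLp_likelihoodRatio hθ d k n).integrable_mul (memLp_evalAt_null g)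
    simp only [sub_mul] at horth
    rw [integral_sub h1 (integrable_evalAt_mul_null g g), sub_eq_zero] at horth
    rw [← integral_toReal_rnDeriv_mul (planted_absolutelyContinuous hθ d k n)]
    simp only [pow_two] at hG
    rw [hG]
    exact horth
  set h : SamplePoly n d := g - C c
  have hev : ∀ z, h.evalAt z = g.evalAt z - c := fun z => by simp [h, SamplePoly.evalAt]
  have hdeg : h.totalDegree ≤ D := (totalDegree_sub_C_le _ _).trans hg
  have hnull : ∫ z, h.evalAt z ∂(null d n) = 0 := by
    simp_rw [hev]
    rw [integral_sub (integrable_evalAt_null g) (integrable_const _)]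
    simp [hc]
  have hP : ∫ z, h.evalAt z ∂(planted θ d k n) = G - c := by
    simp_rw [hev]
    rw [integral_sub (integrable_evalAt_planted hθ k g) (integrable_const _), hPG]
    simp
  have hsq : ∫ z, h.evalAt z ^ 2 ∂(null d n) = G - c ^ 2 := by
    have e : ∀ z, h.evalAt z ^ 2 = g.evalAt z ^ 2 - (2 * c * g.evalAt z - c ^ 2) := fun z => by
      rw [hev]; ring
    simp_rw [e]
    have hlin : Integrable (fun z => 2 * c * g.evalAt z - c ^ 2) (null d n) :=
      ((integrable_evalAt_null g).const_mul _).sub (integrable_const _)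
    rw [integral_sub (memLp_evalAt_null g).integrable_sq hlin,
      integral_sub ((integrable_evalAt_null g).const_mul _) (integrable_const _),
      integral_const_mul, ← hc, ← hG]
    simp
    ring
  have hmain := sq_integral_planted_le hθ k hdeg hnull
  have hnn : 0 ≤ ∫ z, h.evalAt z ^ 2 ∂(null d n) := integral_nonneg fun z => sq_nonneg _
  have h2 : (G - c) ^ 2 ≤ G - c ^ 2 := by
    rw [← hP, ← hsq]
    exact hmain.trans (mul_le_of_le_one_left hnn hV)
  -- Adding `(G - 2c)² ≥ 0` eliminates the mean `c` and leaves `G² ≤ 2G`, so its value is not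
  -- needed.
  by_contra! hlt
  nlinarith [sq_nonneg (G - 2 * c)]

end Projection

/-! ### The growth assumption makes the geometric ratio small -/

section Asymptotics

lemma eventually_energy_ratio_le {δ : ℝ} (hδ : δ ∈ Set.Ioc (0 : ℝ) (1 / 10)) {d k : ℕ → ℕ}
    (hkd : ∀ n, k n ≤ d n)
    (hn : (fun n : ℕ => (n : ℝ)) =o[atTop]
      fun n : ℕ => min (d n : ℝ) ((k n : ℝ) ^ (2 - δ))) :
    ∀ᶠ n : ℕ in atTop, 4 * Real.exp 1 ^ 2 *
      ((n + (⌊(k n : ℝ) ^ δ⌋₊ : ℝ)) * ((⌊(k n : ℝ) ^ δ⌋₊ : ℝ) + (k n : ℝ) ^ 2 / d n) /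
        ((k n : ℝ) + 1) ^ 2) ≤ 1 / 2 := by
  -- With `e² ≤ 7.5` and four products each at most `ε k²`, the total is `4 · 7.5 · 4ε = 1/2`. The
  -- threshold `240 ^ 4` forces `k ≥ 240²` through `n ≤ k²`, whence `√k ≤ ε k`.
  set ε : ℝ := 1 / 240 with hε
  filter_upwards [hn.bound (show 0 < ε by norm_num), eventually_ge_atTop (240 ^ 4)] with n hb hn4
  obtain ⟨hδ0, hδ1⟩ := hδ
  have hmin0 : 0 ≤ min (d n : ℝ) ((k n : ℝ) ^ (2 - δ)) := by positivity
  rw [Real.norm_of_nonneg (Nat.cast_nonneg n), Real.norm_of_nonneg hmin0] at hb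
  have hnd : (n : ℝ) ≤ ε * d n := hb.trans (by gcongr; exact min_le_left _ _)
  have hnk : (n : ℝ) ≤ ε * (k n : ℝ) ^ (2 - δ) := hb.trans (by gcongr; exact min_le_right _ _)
  have hn4' : (240 : ℝ) ^ 4 ≤ n := by exact_mod_cast hn4
  have hk0 : k n ≠ 0 := by
    intro h0
    rw [h0, Nat.cast_zero, Real.zero_rpow (by linarith)] at hnk
    linarith [show (0 : ℝ) < 240 ^ 4 by norm_num]
  have hk1 : (1 : ℝ) ≤ k n := by exact_mod_cast Nat.one_le_iff_ne_zero.2 hk0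
  have hkpos : (0 : ℝ) < k n := by linarith
  have hkd' : (k n : ℝ) ≤ d n := by exact_mod_cast hkd n
  have hdpos : (0 : ℝ) < d n := by linarith
  have hk2 : (240 : ℝ) ^ 2 ≤ k n := by
    have h1 : (k n : ℝ) ^ (2 - δ) ≤ (k n : ℝ) ^ 2 := by
      rw [← Real.rpow_two]
      exact Real.rpow_le_rpow_of_exponent_le hk1 (by linarith)
    have h2 : ((240 : ℝ) ^ 2) ^ 2 ≤ (k n : ℝ) ^ 2 := by
      have : ε * (k n : ℝ) ^ (2 - δ) ≤ 1 * (k n : ℝ) ^ 2 := by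
        gcongr
        norm_num [hε]
      linarith
    exact (pow_le_pow_iff_left₀ (by norm_num) hkpos.le two_ne_zero).1 h2
  set κ : ℝ := (k n : ℝ) ^ δ with hκ
  have hκ0 : 0 ≤ κ := by positivity
  have hκsq : κ ^ 2 ≤ k n := by
    rw [hκ, ← Real.rpow_natCast, ← Real.rpow_mul hkpos.le]
    calc (k n : ℝ) ^ (δ * (2 : ℕ)) ≤ (k n : ℝ) ^ (1 : ℝ) :=
          Real.rpow_le_rpow_of_exponent_le hk1 (by push_cast; linarith)
      _ = k n := Real.rpow_one _
  have hκk : κ ≤ ε * k n := by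
    refine le_of_sq_le_sq ?_ (by positivity)
    calc κ ^ 2 ≤ k n := hκsq
      _ ≤ (ε * k n) ^ 2 := by rw [hε]; nlinarith
  -- The exponent `2 - δ` is used here: it leaves exactly the room `k^δ` taken up by the degree.
  have hnκ : (n : ℝ) * κ ≤ ε * (k n : ℝ) ^ 2 := by
    calc (n : ℝ) * κ ≤ ε * (k n : ℝ) ^ (2 - δ) * κ := by gcongr
      _ = ε * (k n : ℝ) ^ 2 := by
          rw [mul_assoc, hκ, ← Real.rpow_add hkpos, ← Real.rpow_two]
          congr 2
          ring
  have hfl : (⌊κ⌋₊ : ℝ) ≤ κ := Nat.floor_le hκ0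
  have he : Real.exp 1 ^ 2 ≤ 7.5 := by
    have := Real.exp_one_lt_d9
    nlinarith [Real.exp_pos 1]
  have hratio : (n + (⌊κ⌋₊ : ℝ)) * ((⌊κ⌋₊ : ℝ) + (k n : ℝ) ^ 2 / d n) / ((k n : ℝ) + 1) ^ 2 ≤
      4 * ε := by
    calc _ ≤ (n + κ) * (κ + (k n : ℝ) ^ 2 / d n) / (k n : ℝ) ^ 2 := by
          gcongr
          linarith
      _ ≤ 4 * ε := by
          rw [div_le_iff₀ (by positivity)]
          have h1 : (n : ℝ) * ((k n : ℝ) ^ 2 / d n) ≤ ε * (k n : ℝ) ^ 2 := by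
            rw [mul_div_assoc', div_le_iff₀ hdpos]
            nlinarith [sq_nonneg (k n : ℝ)]
          have h2 : κ * ((k n : ℝ) ^ 2 / d n) ≤ ε * (k n : ℝ) ^ 2 := by
            rw [mul_div_assoc', div_le_iff₀ hdpos]
            have : κ ≤ ε * d n := hκk.trans (by gcongr)
            nlinarith [sq_nonneg (k n : ℝ)]
          have h3 : κ * κ ≤ ε * (k n : ℝ) ^ 2 := by
            rw [hε]
            nlinarith
          calc _ = (n : ℝ) * κ + n * ((k n : ℝ) ^ 2 / d n) +
                (κ * κ + κ * ((k n : ℝ) ^ 2 / d n)) := by ring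
            _ ≤ (ε * (k n : ℝ) ^ 2 + ε * (k n : ℝ) ^ 2) +
                (ε * (k n : ℝ) ^ 2 + ε * (k n : ℝ) ^ 2) :=
              add_le_add (add_le_add hnκ h1) (add_le_add h3 h2)
            _ = _ := by ring
  calc _ ≤ 4 * 7.5 * (4 * ε) := by gcongr
    _ ≤ 1 / 2 := by rw [hε]; norm_num

end Asymptotics

end NegSPCA

end

/-- Asymptotics are for `n → ∞`, with `d = d n` and `k = k n`. The first part bounds the advantage
of centred polynomials of degree at most `k ^ δ` by `1 + o(1)`, where the `o(1)` is uniform in `θ`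
and in the polynomial; the second part says that the norm in `L²` of the null distribution of the
low-degree likelihood ratio stays bounded. -/
theorem theoremB3 (δ : ℝ) (hδ : δ ∈ Set.Ioc (0 : ℝ) (1 / 10)) (d k : ℕ → ℕ)
    (hkd : ∀ n, k n ≤ d n)
    (hn : (fun n : ℕ => (n : ℝ)) =o[atTop]
      fun n : ℕ => min (d n : ℝ) ((k n : ℝ) ^ (2 - δ))) :
    (∀ ε : ℝ, 0 < ε → ∀ᶠ n : ℕ in atTop, ∀ θ ∈ Set.Ioo (0 : ℝ) 1,
      ∀ f : NegSPCA.SamplePoly n (d n), (f.totalDegree : ℝ) ≤ (k n : ℝ) ^ δ →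
        ∫ z, f.evalAt z ∂(NegSPCA.null (d n) n) = 0 →
        (∫ z, f.evalAt z ∂(NegSPCA.planted θ (d n) (k n) n)) /
          √(∫ z, f.evalAt z ^ 2 ∂(NegSPCA.null (d n) n)) ≤ 1 + ε) ∧
    (∃ C : ℝ, ∀ᶠ n : ℕ in atTop, ∀ θ ∈ Set.Ioo (0 : ℝ) 1,
      ∃ g : NegSPCA.SamplePoly n (d n),
        NegSPCA.IsLowDegreeLR (NegSPCA.planted θ (d n) (k n) n) (NegSPCA.null (d n) n)
          ((k n : ℝ) ^ δ) g ∧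
        √(∫ z, g.evalAt z ^ 2 ∂(NegSPCA.null (d n) n)) ≤ C) := by
  have hev := NegSPCA.eventually_energy_ratio_le hδ hkd hn
  have hfloor : ∀ (n m : ℕ), (m : ℝ) ≤ (k n : ℝ) ^ δ ↔ m ≤ ⌊(k n : ℝ) ^ δ⌋₊ := fun n m =>
    (Nat.le_floor_iff (by positivity)).symm
  refine ⟨fun ε hε => ?_, 2, ?_⟩
  · filter_upwards [hev] with n hr θ hθ f hf h0
    have hV := NegSPCA.hermiteEnergy_le_one hθ (hkd n) n _ hr
    have hsq := NegSPCA.sq_integral_planted_le hθ (k n) ((hfloor n _).1 hf) h0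
    have hnn : 0 ≤ ∫ z, f.evalAt z ^ 2 ∂(NegSPCA.null (d n) n) :=
      integral_nonneg fun z => sq_nonneg _
    -- The advantage is in fact at most `1`. A vanishing denominator causes no trouble, since the
    -- quotient is then `0`.
    refine (div_le_one_of_le₀ ?_ (Real.sqrt_nonneg _)).trans (by linarith)
    exact Real.le_sqrt_of_sq_le (hsq.trans (mul_le_of_le_one_left hnn hV))
  · filter_upwards [hev] with n hr θ hθ
    have hV := NegSPCA.hermiteEnergy_le_one hθ (hkd n) n _ hr
    have hL := NegSPCA.memLp_likelihoodRatio hθ (d n) (k n) n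
    obtain ⟨g, hg, horth⟩ := NegSPCA.exists_lowDegree_projection hL ⌊(k n : ℝ) ^ δ⌋₊
    refine ⟨g, ⟨NegSPCA.planted_absolutelyContinuous hθ _ _ _, hL, (hfloor n _).2 hg,
      fun h hh => horth h ((hfloor n _).1 hh)⟩, ?_⟩
    -- With `C = 2` the requirement is `E_Q g² ≤ 4`, implied by the bound `2`.
    rw [Real.sqrt_le_left (by norm_num)]
    linarith [NegSPCA.integral_sq_projection_le hθ (hkd n) hV hg (horth g hg)]
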